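/- Let $\lambda\in\mathbb C$ with $\operatorname{Re}\lambda>1$ and let $L=A(x,y)\,\partial_x+B(x,y)\,\partial_y$ be a complex vector field on $\mathbb R^2$ whose coefficients $A,B$ are $C^\infty$ in $\mathbb R^2\setminus\{0\}$ and homogeneous of degree $\lambda$, that is, $A(tx,ty)=t^\lambda A(x,y)$ and $B(tx,ty)=t^\lambda B(x,y)$ for all $(x,y)\in\mathbb R^2$ and $t>0$. Assume that the set $\{\operatorname{Im}(A\overline B)=0\}$ has empty interior in $\mathbb R^2$, and that $L\wedge(x\,\partial_x+y\,\partial_y)\neq0$ everywhere in $\mathbb R^2\setminus\{0\}$. Put $a(\theta)=A(\cos\theta,\sin\theta)$, $b(\theta)=B(\cos\theta,\sin\theta)$, $p(\theta)=b(\theta)\cos\theta-a(\theta)\sin\theta$, $q(\theta)=i\,(a(\theta)\cos\theta+b(\theta)\sin\theta)$ and $$\mu=\frac1{2\pi}\int_0^{2\pi}\frac{q(\theta)}{p(\theta)}\,d\theta .$$ Suppose that $\mu\neq0$; that $(\mu,\lambda)$ is nonresonant, i.e. there are no integers $l\ge1$ and $k$ with $\mu\lambda=\mu l+k$; and that there is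 a constant $C>0$ such that $|1-e^{2\pi i\mu(j-\lambda)}|\ge C^{\,j}$ for every integer $j\ge1$. Then for every complex-valued function $f$ that is real analytic at $0\in\mathbb R^2$ there exist $\varepsilon>0$, such that $f$ is real analytic in the disc $D(0,\varepsilon)$, and a bounded function $w\in C^\infty(D(0,\varepsilon)\setminus\{0\})$ such that $u=w/r^{\lambda-1}$, where $r=\sqrt{x^2+y^2}$, is a distribution solution of $Lu=f$ in $D(0,\varepsilon)$. Here the last assertion means the following. Let $n$ be the largest integer less than $\operatorname{Re}\lambda-1$. There is a distribution $U$ of order at most $n$ in $D(0,\varepsilon)$ (a continuous linear functional on the space $C^n_c(D(0,\varepsilon))$ of compactly supported complex-valued $C^n$ functions) such that $\langle U,\Phi\rangle=\int u\,\Phi\,dx\,dy$ for every $\Phi\in C^n_c(D(0,\varepsilon))$ for which $u\,\Phi$ is integrable, and such that for every $\Phi\in C^\infty_c(D(0,\varepsilon))$ the function ${}^tL\Phi=-\partial_x(A\Phi)-\partial_y(B\Phi)$ belongs to $C^n_c(D(0,\varepsilon))$ and $\langle U,{}^tL\Phi\rangle=\int f\,\Phi\,dx\,dy$. -/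

import Mathlib

open scoped ContDiff Distributions

noncomputable section

/-- A complex vector field `L = A ∂x + B ∂y` on the plane `ℝ²` with coefficients smooth outside
the origin and homogeneous of degree `lam`, where `Re lam > 1`.

The plane is the real vector space `ℂ`, with `z = x + i y`, its Euclidean norm `r = ‖z‖` and
Lebesgue measure. All derivatives and all notions of smoothness and analyticity in the plane are
real ones. -/
structure HomogeneousVectorField (lam : ℂ) where
  A : ℂ → ℂ
  B : ℂ → ℂ
  one_lt_re : 1 < lam.re
  smooth_A : ContDiffOn ℝ ∞ A {0}ᶜ
  smooth_B : ContDiffOn ℝ ∞ B {0}ᶜ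
  homog_A : ∀ t : ℝ, 0 < t → ∀ z : ℂ, A (t * z) = (t : ℂ) ^ lam * A z
  homog_B : ∀ t : ℝ, 0 < t → ∀ z : ℂ, B (t * z) = (t : ℂ) ^ lam * B z

namespace HomogeneousVectorField

variable {lam : ℂ} (L : HomogeneousVectorField lam)

/-- The set of points where `L` is not elliptic, `Im (A * conj B) = 0`. -/
def charSet : Set ℂ := {z | (L.A z * (starRingEnd ℂ) (L.B z)).im = 0}

/-- The characteristic set has empty interior. -/
def CondC1 : Prop := interior L.charSet = ∅

/-- `L ∧ (x ∂x + y ∂y) ≠ 0` outside the origin. -/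
def CondC2 : Prop := ∀ z : ℂ, z ≠ 0 → L.A z * (z.im : ℂ) - L.B z * (z.re : ℂ) ≠ 0

/-- `p(θ) = b(θ) cos θ - a(θ) sin θ`, where `a`, `b` are the restrictions of `A`, `B` to the unit
circle; in polar coordinates, `L = r ^ (lam - 1) (p(θ) ∂θ - i q(θ) r ∂r)`. -/
def p (θ : ℝ) : ℂ :=
  L.B (Complex.exp (θ * Complex.I)) * (Real.cos θ : ℂ)
    - L.A (Complex.exp (θ * Complex.I)) * (Real.sin θ : ℂ)

/-- `q(θ) = i (a(θ) cos θ + b(θ) sin θ)`. -/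
def q (θ : ℝ) : ℂ :=
  Complex.I * (L.A (Complex.exp (θ * Complex.I)) * (Real.cos θ : ℂ)
    + L.B (Complex.exp (θ * Complex.I)) * (Real.sin θ : ℂ))

/-- The number `μ(L) = (1 / 2π) ∫₀^{2π} q(θ) / p(θ) dθ`. -/
def mu : ℂ := 1 / (2 * (Real.pi : ℂ)) * ∫ θ in (0 : ℝ)..(2 * Real.pi), L.q θ / L.p θ

/-- The transpose of `L`, `ᵗL Φ = -(∂x (A Φ) + ∂y (B Φ))`. -/
def transpose (Φ : ℂ → ℂ) (z : ℂ) : ℂ :=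
  -(fderiv ℝ (fun ζ => L.A ζ * Φ ζ) z 1 + fderiv ℝ (fun ζ => L.B ζ * Φ ζ) z Complex.I)

end HomogeneousVectorField

/-- The pair `(μ, lam)` is resonant: `μ lam = μ l + k` for some integers `l ≥ 1` and `k`. -/
def IsResonant (μ lam : ℂ) : Prop := ∃ l k : ℤ, 1 ≤ l ∧ μ * lam = μ * l + k

/-- The Diophantine condition. -/
def DiophantineDC (μ lam : ℂ) : Prop :=
  ∃ C : ℝ, 0 < C ∧ ∀ j : ℕ, 1 ≤ j →
    C ^ j ≤ ‖1 - Complex.exp (2 * Real.pi * Complex.I * μ * ((j : ℂ) - lam))‖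

/-- The open disc of radius `ε` about the origin. -/
def disc (ε : ℝ) : TopologicalSpace.Opens ℂ := ⟨Metric.ball 0 ε, Metric.isOpen_ball⟩

/-- The largest integer less than `Re lam - 1` (for `Re lam > 1`). For a homogeneous vector field
of degree `lam` and a smooth test function `Φ`, the function `ᵗL Φ` is of class `C ^ n` with
`n = pairingOrder lam`, but in general not smooth at the origin; hence `L U` makes sense near the
origin for distributions `U` of order at most `n`. -/
def pairingOrder (lam : ℂ) : ℕ := ⌈lam.re⌉₊ - 2

/-- The distribution `U`, of order at most `n`, is given by the function `u`: its value at a test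
function `Φ` is `∫ u Φ` whenever this integral converges absolutely. If `u` is locally integrable
then `U` is the usual distribution defined by `u`; if `u` is only locally integrable outside the
origin, then `U` is a regularization of `u`, and it equals `u` outside the origin. -/
def IsGivenBy {Ω : TopologicalSpace.Opens ℂ} {n : ℕ∞} (U : 𝓓^{n}(Ω, ℂ) →L[ℂ] ℂ) (u : ℂ → ℂ) :
    Prop :=
  ∀ Φ : 𝓓^{n}(Ω, ℂ), MeasureTheory.IntegrableOn (fun z => u z * Φ z) (Ω : Set ℂ) →
    U Φ = ∫ z in (Ω : Set ℂ), u z * Φ z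

/-- `L U = f` in `Ω` in the sense of distributions: `⟨U, ᵗL Φ⟩ = ∫ f Φ` for every smooth compactly
supported `Φ` in `Ω`. It is part of the assertion that `ᵗL Φ` is one of the `C ^ n` functions with
compact support in `Ω` on which `U` is defined. -/
def SolvesInDistributions {lam : ℂ} (L : HomogeneousVectorField lam)
    {Ω : TopologicalSpace.Opens ℂ} {n : ℕ∞} (U : 𝓓^{n}(Ω, ℂ) →L[ℂ] ℂ) (f : ℂ → ℂ) : Prop :=
  ∀ Φ : 𝓓(Ω, ℂ), ∃ Ψ : 𝓓^{n}(Ω, ℂ), (∀ z, Ψ z = L.transpose Φ z) ∧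
    U Ψ = ∫ z in (Ω : Set ℂ), f z * Φ z

/-- The function `u` is a distribution solution of `L u = f` in `Ω`. -/
def IsDistributionSolution {lam : ℂ} (L : HomogeneousVectorField lam)
    (Ω : TopologicalSpace.Opens ℂ) (u f : ℂ → ℂ) : Prop :=
  ∃ U : 𝓓^{(pairingOrder lam : ℕ∞)}(Ω, ℂ) →L[ℂ] ℂ,
    IsGivenBy U u ∧ SolvesInDistributions L U f

end

/-! In logarithmic polar coordinates `z = e ^ ζ`, `ζ = t + iθ`, put `u = r ^ (1 - lam) w` and `W ζ =
w (e ^ ζ)`. The powers of `r` cancel and `L u = f` becomes `p W_θ - i q (W_t + (1 - lam) W) = f`.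
Expand `f = ∑ F j` into homogeneous polynomials and look for `W = ∑ e ^ (j t) v j θ`; each `v j`
must be a periodic solution of `v' = i (j + 1 - lam) (q / p) v + F j / p`.

The monodromy of this equation is `exp (2πiμ (j + 1 - lam))`. The Diophantine condition keeps it
away from `1`, with an inverse distance growing at most geometrically, so the `v j` are
geometrically bounded and the series converges for small `r` (`exists_periodic_solution`,
`exists_coefficients`). A `t`-derivative only multiplies terms by `j`, and the equation trades
`θ`-derivatives for `t`-derivatives, whence smoothness (`expSeries.contDiffOn`). This gives a
solution in a punctured disc with `w` bounded.

At the origin `u = O(r ^ (1 - Re lam))`. With `n = pairingOrder lam` one has `n ≥ Re lam - 2`, so `r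
^ n u = O(1 / r)` is integrable and `u` extends to a distribution of order at most `n`, by
subtracting from a test function a correction depending only on its jet (`exists_isGivenBy`). Since
`ᵗL Φ = O(r ^ (Re lam - 1))`, the product `u ᵗL Φ` is integrable and its pairing is an ordinary
integral. The divergence theorem then gives the weak equation, since the field `u (A Φ, B Φ)` is
`O(r)` and the origin contributes nothing (`setIntegral_mul_transpose`). -/

/-! ### Homogeneous functions near the origin. -/

/-- A function on the plane bounded on the unit circle and homogeneous of degree `lam` is
bounded by a multiple of `‖z‖ ^ Re lam` outside the origin. -/
theorem exists_norm_le_of_homogeneous {F : Type*} [NormedAddCommGroup F] [NormedSpace ℂ F]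
    {g : ℂ → F} {lam : ℂ} (hc : ContinuousOn g {0}ᶜ)
    (hg : ∀ t : ℝ, 0 < t → ∀ z : ℂ, g (t * z) = (t : ℂ) ^ lam • g z) :
    ∃ M : ℝ, 0 ≤ M ∧ ∀ z : ℂ, z ≠ 0 → ‖g z‖ ≤ M * ‖z‖ ^ lam.re := by
  have hs : ContinuousOn g (Metric.sphere 0 1) := hc.mono fun z hz => by
    simp only [Set.mem_compl_iff, Set.mem_singleton_iff]
    rintro rfl
    simp at hz
  obtain ⟨M, hM⟩ := (isCompact_sphere (0 : ℂ) 1).exists_bound_of_continuousOn hs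
  refine ⟨max M 0, le_max_right _ _, fun z hz => ?_⟩
  have hz' : 0 < ‖z‖ := norm_pos_iff.2 hz
  have hmul : (‖z‖ : ℂ) * (z / ‖z‖) = z :=
    mul_div_cancel₀ _ (by exact_mod_cast hz'.ne')
  have h := hg ‖z‖ hz' (z / ‖z‖)
  rw [hmul] at h
  rw [h, norm_smul, Complex.norm_cpow_eq_rpow_re_of_pos hz', mul_comm]
  gcongr
  exact (hM _ (by simp [hz])).trans (le_max_left _ _)

/-- Dilation by `2` fixes the origin but multiplies norms by `2 ^ Re lam > 1`. -/
theorem homogeneous_apply_zero {F : Type*} [NormedAddCommGroup F] [NormedSpace ℂ F]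
    {g : ℂ → F} {lam : ℂ} (hlam : 0 < lam.re)
    (hg : ∀ t : ℝ, 0 < t → ∀ z : ℂ, g (t * z) = (t : ℂ) ^ lam • g z) : g 0 = 0 := by
  have h := congrArg norm (hg 2 two_pos 0)
  rw [mul_zero, norm_smul, Complex.norm_cpow_eq_rpow_re_of_pos two_pos] at h
  have h1 : (1 : ℝ) < 2 ^ lam.re := Real.one_lt_rpow one_lt_two hlam
  have h2 := norm_nonneg (g 0)
  rw [← norm_eq_zero]
  nlinarith

/-- Differentiate the homogeneity relation in `z`. Both chain rules used hold without
differentiability, so the origin needs no separate treatment. -/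
theorem homogeneous_fderiv {F : Type*} [NormedAddCommGroup F] [NormedSpace ℂ F]
    {g : ℂ → F} {lam : ℂ}
    (hg : ∀ t : ℝ, 0 < t → ∀ z : ℂ, g (t * z) = (t : ℂ) ^ lam • g z) {t : ℝ} (ht : 0 < t) (z : ℂ) :
    fderiv ℝ g (t * z) = (t : ℂ) ^ (lam - 1) • fderiv ℝ g z := by
  have ht0 : (t : ℂ) ≠ 0 := by exact_mod_cast ht.ne'
  have h1 : (fun z : ℂ => g (t • z)) = fun z => (t : ℂ) ^ lam • g z := by
    funext z
    rw [Complex.real_smul, hg t ht]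
  have h2 : fderiv ℝ (fun z : ℂ => g (t • z)) z = t • fderiv ℝ g (t • z) := fderiv_comp_smul t
  have h3 : fderiv ℝ (fun z : ℂ => (t : ℂ) ^ lam • g z) z = (t : ℂ) ^ lam • fderiv ℝ g z :=
    congrFun (fderiv_const_smul_field _) z
  rw [h1, h3, Complex.real_smul] at h2
  rw [Complex.cpow_sub _ _ ht0, Complex.cpow_one, div_eq_inv_mul, mul_smul, h2,
    ← Complex.coe_smul, inv_smul_smul₀ ht0]

/-- Homogeneity gives `g = O(‖z‖ ^ Re lam)`, which is `o(‖z‖)` because `Re lam > 1`. -/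
theorem hasFDerivAt_zero_of_homogeneous {F : Type*} [NormedAddCommGroup F] [NormedSpace ℂ F]
    {g : ℂ → F} {lam : ℂ} (hlam : 1 < lam.re) (hc : ContinuousOn g {0}ᶜ)
    (hg : ∀ t : ℝ, 0 < t → ∀ z : ℂ, g (t * z) = (t : ℂ) ^ lam • g z) :
    HasFDerivAt g (0 : ℂ →L[ℝ] F) 0 := by
  obtain ⟨M, hM, hb⟩ := exists_norm_le_of_homogeneous hc hg
  have h0 : g 0 = 0 := homogeneous_apply_zero (by linarith) hg
  rw [hasFDerivAt_iff_isLittleO_nhds_zero]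
  simp only [zero_add, h0, sub_zero, _root_.zero_apply]
  have h1 : g =O[nhds 0] fun z : ℂ => ‖z‖ ^ lam.re := by
    refine Asymptotics.IsBigO.of_bound M (Filter.Eventually.of_forall fun z => ?_)
    rcases eq_or_ne z 0 with rfl | hz
    · rw [h0, norm_zero]; positivity
    · rw [Real.norm_of_nonneg (by positivity)]
      exact hb z hz
  refine h1.trans_isLittleO ?_
  rw [← Asymptotics.isLittleO_norm_right, Asymptotics.isLittleO_iff_tendsto' ?_]
  · have : Filter.Tendsto (fun z : ℂ => ‖z‖ ^ (lam.re - 1)) (nhds 0) (nhds 0) := by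
      have := (continuous_norm (E := ℂ)).rpow_const (p := lam.re - 1) fun _ => Or.inr (by linarith)
      have := this.tendsto 0
      rwa [norm_zero, Real.zero_rpow (by linarith)] at this
    refine this.congr fun z => ?_
    rcases eq_or_ne z 0 with rfl | hz
    · simp [Real.zero_rpow (show lam.re - 1 ≠ 0 by linarith)]
    · rw [Real.rpow_sub_one (norm_ne_zero_iff.2 hz)]
  · refine Filter.Eventually.of_forall fun z hz => ?_
    rw [hz, Real.zero_rpow (by linarith)]

theorem continuous_of_homogeneous {F : Type*} [NormedAddCommGroup F] [NormedSpace ℂ F]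
    {g : ℂ → F} {lam : ℂ} (hlam : 0 < lam.re) (hc : ContinuousOn g {0}ᶜ)
    (hg : ∀ t : ℝ, 0 < t → ∀ z : ℂ, g (t * z) = (t : ℂ) ^ lam • g z) : Continuous g := by
  obtain ⟨M, hM, hb⟩ := exists_norm_le_of_homogeneous hc hg
  have h0 : g 0 = 0 := homogeneous_apply_zero hlam hg
  rw [continuous_iff_continuousAt]
  intro z
  rcases eq_or_ne z 0 with rfl | hz
  · rw [ContinuousAt, h0]
    refine squeeze_zero_norm (a := fun z => M * ‖z‖ ^ lam.re) (fun z => ?_) ?_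
    · rcases eq_or_ne z 0 with rfl | hz
      · rw [h0, norm_zero]; positivity
      · exact hb z hz
    · have : Continuous fun z : ℂ => M * ‖z‖ ^ lam.re := continuous_const.mul
        ((continuous_norm (E := ℂ)).rpow_const (p := lam.re) fun _ => Or.inr hlam.le)
      simpa [Real.zero_rpow hlam.ne'] using this.tendsto 0
  · exact hc.continuousAt (isOpen_compl_singleton.mem_nhds hz)

/-- A function smooth outside the origin and homogeneous of degree `lam` is of class `C ^ n` for
`n < Re lam`. -/
theorem contDiff_of_homogeneous (n : ℕ) : ∀ {F : Type} [NormedAddCommGroup F] [NormedSpace ℂ F]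
    {g : ℂ → F} {lam : ℂ} (_ : (n : ℝ) < lam.re) (_ : ContDiffOn ℝ ∞ g {0}ᶜ)
    (_ : ∀ t : ℝ, 0 < t → ∀ z : ℂ, g (t * z) = (t : ℂ) ^ lam • g z), ContDiff ℝ n g := by
  -- The target space varies in the induction: the hypothesis is applied to `fderiv ℝ g`,
  -- homogeneous of degree `lam - 1`.
  induction n with
  | zero =>
    intro F _ _ g lam hlam hc hg
    exact contDiff_zero.2 (continuous_of_homogeneous (by simpa using hlam) hc.continuousOn hg)
  | succ n ih =>
    intro F _ _ g lam hlam hc hg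
    push_cast at hlam
    have hn : (0 : ℝ) ≤ n := n.cast_nonneg
    rw [show ((n + 1 : ℕ) : WithTop ℕ∞) = n + 1 by norm_cast, contDiff_succ_iff_fderiv]
    refine ⟨fun z => ?_, by simp, ?_⟩
    · rcases eq_or_ne z 0 with rfl | hz
      · exact (hasFDerivAt_zero_of_homogeneous (by linarith) hc.continuousOn hg).differentiableAt
      · exact (hc.contDiffAt (isOpen_compl_singleton.mem_nhds hz)).differentiableAt (by simp)
    · refine ih (lam := lam - 1) ?_ ?_ fun t ht z => homogeneous_fderiv hg ht z
      · simp only [Complex.sub_re, Complex.one_re]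
        linarith
      · exact hc.fderiv_of_isOpen isOpen_compl_singleton (by simp)

/-! ### Jets of test functions and Taylor bounds. -/

/-- A function whose derivatives of order less than `n` vanish at the origin is bounded by
`‖z‖ ^ n` times the supremum of its `n`-th derivative. -/
theorem norm_le_pow_of_iteratedFDeriv_eq_zero (n : ℕ) {E : Type} [NormedAddCommGroup E]
    [NormedSpace ℝ E] : ∀ {F : Type} [NormedAddCommGroup F] [NormedSpace ℝ F]
    {g : E → F} {M : ℝ} (_ : ContDiff ℝ n g) (_ : ∀ k < n, iteratedFDeriv ℝ k g 0 = 0)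
    (_ : ∀ z, ‖iteratedFDeriv ℝ n g z‖ ≤ M) (z : E), ‖g z‖ ≤ M * ‖z‖ ^ n := by
  induction n with
  | zero =>
    intro F _ _ g M _ _ hM z
    simpa using hM z
  | succ n ih =>
    intro F _ _ g M hg h0 hM z
    rw [show ((n + 1 : ℕ) : WithTop ℕ∞) = n + 1 by norm_cast, contDiff_succ_iff_fderiv] at hg
    have hM0 : 0 ≤ M := (norm_nonneg _).trans (hM 0)
    have h1 := ih (g := fderiv ℝ g) (M := M) hg.2.2
      (fun k hk => by
        rw [← norm_eq_zero, norm_iteratedFDeriv_fderiv, h0 _ (by omega), norm_zero])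
      (fun z => by rw [norm_iteratedFDeriv_fderiv]; exact hM z)
    have hg0 : g 0 = 0 := by
      have := h0 0 (by omega)
      rw [← norm_eq_zero, norm_iteratedFDeriv_zero] at this
      exact norm_eq_zero.1 this
    -- Mean value inequality on the ball of radius `‖z‖`, where the derivative is at most `M * ‖z‖ ^
    -- n`.
    have h2 := (convex_closedBall (0 : E) ‖z‖).norm_image_sub_le_of_norm_fderiv_le (𝕜 := ℝ)
      (f := g) (C := M * ‖z‖ ^ n) (fun x _ => hg.1 x) (fun x hx => (h1 x).trans (by
        gcongr
        simpa using hx)) (x := 0) (y := z) (by simp) (by simp)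
    rw [hg0, sub_zero, sub_zero] at h2
    rwa [pow_succ, ← mul_assoc]

theorem ContinuousMultilinearMap.eq_zero_of_basis {R ι E F κ : Type*} [Field R] [Finite ι]
    [AddCommGroup E] [Module R E] [TopologicalSpace E] [AddCommGroup F] [Module R F]
    [TopologicalSpace F] (b : Module.Basis κ R E)
    (T : ContinuousMultilinearMap R (fun _ : ι => E) F) (h : ∀ s : ι → κ, T (fun i => b (s i)) = 0) :
    T = 0 :=
  ContinuousMultilinearMap.toMultilinearMap_injective
    (Module.Basis.ext_multilinear (fun _ => b) fun s => by simpa using h s)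

namespace TestFunction

open TopologicalSpace BoundedContinuousFunction

theorem locallyConvexSpace_bcf {E G : Type*} [TopologicalSpace E] [NormedAddCommGroup G]
    [NormedSpace ℝ G] : LocallyConvexSpace ℝ (E →ᵇ G) :=
  NormedSpace.toLocallyConvexSpace

theorem continuous_norm_bcf {X E G : Type*} [TopologicalSpace X] [TopologicalSpace E]
    [NormedAddCommGroup G] {φ : X → E →ᵇ G} (hφ : Continuous φ) : Continuous fun x => ‖φ x‖ :=
  hφ.norm

/-- The `i`-th derivative, as a continuous linear map from the test functions of class `C ^ n` to
the bounded continuous functions; it is zero for `i > n`. -/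
noncomputable def iteratedFDerivBCF {E : Type} [NormedAddCommGroup E] [NormedSpace ℝ E]
    (Ω : Opens E) (n : ℕ∞) (i : ℕ) :
    𝓓^{n}(Ω, ℂ) →L[ℂ] E →ᵇ (ContinuousMultilinearMap ℝ (fun _ : Fin i => E) ℂ) :=
  letI : SeminormedAddCommGroup (E →ᵇ (ContinuousMultilinearMap ℝ (fun _ : Fin i => E) ℂ)) :=
    inferInstance
  haveI : IsTopologicalAddGroup (E →ᵇ (ContinuousMultilinearMap ℝ (fun _ : Fin i => E) ℂ)) :=
    inferInstance
  haveI : LocallyConvexSpace ℝ (E →ᵇ (ContinuousMultilinearMap ℝ (fun _ : Fin i => E) ℂ)) :=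
    locallyConvexSpace_bcf
  TestFunction.limitCLM (𝕜 := ℂ) (Ω := Ω) (F := ℂ) (n := n)
    (V := E →ᵇ (ContinuousMultilinearMap ℝ (fun _ : Fin i => E) ℂ))
    -- The value at `f` is computed with its own support as the compact set. Continuity is checked
    -- on each fixed compact `K`, where the same derivative is obtained.
    (fun f => ContDiffMapSupportedIn.structureMapCLM ℂ n i
      (ContDiffMapSupportedIn.of_support_subset (K := ⟨tsupport f, f.hasCompactSupport⟩)
        f.contDiff subset_closure))
    (fun K _ => ContDiffMapSupportedIn.structureMapCLM ℂ n i)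
    (fun _ _ f => by
      apply DFunLike.coe_injective
      rw [ContDiffMapSupportedIn.structureMapCLM_apply,
        ContDiffMapSupportedIn.structureMapCLM_apply]
      rfl)

theorem iteratedFDerivBCF_apply {E : Type} [NormedAddCommGroup E] [NormedSpace ℝ E]
    {Ω : Opens E} {n : ℕ∞} {i : ℕ} (hi : i ≤ n) (f : 𝓓^{n}(Ω, ℂ)) (x : E) :
    iteratedFDerivBCF Ω n i f x = iteratedFDeriv ℝ i f x := by
  rw [iteratedFDerivBCF, TestFunction.limitCLM_apply,
    ContDiffMapSupportedIn.structureMapCLM_apply, if_pos hi]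
  rfl

/-- The jet of order less than `n` at the origin, in terms of a basis. -/
noncomputable def jet {E κ : Type} [NormedAddCommGroup E] [NormedSpace ℝ E]
    (b : Module.Basis κ ℝ E) (Ω : Opens E) (n : ℕ) :
    𝓓^{n}(Ω, ℂ) →L[ℂ] ((Σ k : Fin n, (Fin k → κ)) → ℂ) :=
  ContinuousLinearMap.pi fun s =>
    { toFun f := iteratedFDerivBCF Ω (n : ℕ∞) s.1 f 0 (fun i => b (s.2 i))
      map_add' f g := by simp
      map_smul' c f := by simp
      cont := by
        have h1 : Continuous fun f : 𝓓^{n}(Ω, ℂ) => iteratedFDerivBCF Ω (n : ℕ∞) s.1 f 0 :=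
          (continuous_eval_const (F := E →ᵇ ContinuousMultilinearMap ℝ (fun _ : Fin s.1 => E) ℂ)
            (0 : E)).comp
            (iteratedFDerivBCF Ω (n : ℕ∞) s.1).continuous
        exact (continuous_eval_const (F := ContinuousMultilinearMap ℝ (fun _ : Fin s.1 => E) ℂ)
          (fun i => b (s.2 i))).comp h1 }

/-- Taylor's estimate at the origin. The constant depends continuously on `f`, which will make the
regularized integral a continuous functional. -/
theorem norm_le_of_jet_eq_zero {E κ : Type} [NormedAddCommGroup E] [NormedSpace ℝ E]
    {b : Module.Basis κ ℝ E} {Ω : Opens E} {n : ℕ} {f : 𝓓^{n}(Ω, ℂ)} (hf : jet b Ω n f = 0)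
    (z : E) : ‖f z‖ ≤ ‖iteratedFDerivBCF Ω (n : ℕ∞) n f‖ * ‖z‖ ^ n := by
  refine norm_le_pow_of_iteratedFDeriv_eq_zero n f.contDiff (fun k hk => ?_) (fun z => ?_) z
  · refine ContinuousMultilinearMap.eq_zero_of_basis b _ fun s => ?_
    have := congrFun hf ⟨⟨k, hk⟩, s⟩
    rw [← iteratedFDerivBCF_apply (n := (n : ℕ∞)) (by exact_mod_cast hk.le)]
    exact this
  · rw [← iteratedFDerivBCF_apply (n := (n : ℕ∞)) le_rfl]
    exact BoundedContinuousFunction.norm_coe_le_norm _ z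

end TestFunction

/-! ### Regularization of a singular function. -/

open MeasureTheory TopologicalSpace in
/-- A function which becomes integrable after multiplication by `‖z‖ ^ n` is the restriction of a
distribution of order at most `n`. -/
theorem exists_isGivenBy {Ω : Opens ℂ} (n : ℕ) (u : ℂ → ℂ)
    (hm : AEStronglyMeasurable u (volume.restrict Ω))
    (hu : IntegrableOn (fun z => ‖z‖ ^ n * ‖u z‖) (Ω : Set ℂ)) :
    ∃ U : 𝓓^{(n : ℕ∞)}(Ω, ℂ) →L[ℂ] ℂ, IsGivenBy U u := by
  let J := TestFunction.jet Complex.basisOneI Ω n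
  -- `σ` chooses linearly a test function with each attainable jet, so `P f = f - σ (J f)` has
  -- vanishing jet and `u * P f` is integrable.
  obtain ⟨σ, hσ⟩ := J.toLinearMap.rangeRestrict.exists_rightInverse_of_surjective
    (LinearMap.range_rangeRestrict _)
  let Jr := J.toLinearMap.rangeRestrict
  have hσ' : ∀ e, J (σ e) = e := fun e => congrArg Subtype.val (LinearMap.congr_fun hσ e)
  let P : 𝓓^{(n : ℕ∞)}(Ω, ℂ) →ₗ[ℂ] 𝓓^{(n : ℕ∞)}(Ω, ℂ) := LinearMap.id - σ ∘ₗ Jr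
  have hP : ∀ f, J (P f) = 0 := fun f => by
    change J (f - σ (Jr f)) = 0
    rw [map_sub, hσ']
    exact sub_self _
  let D := TestFunction.iteratedFDerivBCF Ω (n : ℕ∞) n
  have hmul : ∀ f : 𝓓^{(n : ℕ∞)}(Ω, ℂ),
      AEStronglyMeasurable (fun z => u z * f z) (volume.restrict Ω) := fun f =>
    hm.mul f.continuous.aestronglyMeasurable
  have hbd : ∀ f z, ‖u z * P f z‖ ≤ ‖D (P f)‖ * (‖z‖ ^ n * ‖u z‖) := fun f z => by
    rw [norm_mul]
    calc ‖u z‖ * ‖P f z‖ ≤ ‖u z‖ * (‖D (P f)‖ * ‖z‖ ^ n) := by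
          gcongr
          exact TestFunction.norm_le_of_jet_eq_zero (hP f) z
      _ = _ := by ring
  have hint : ∀ f, IntegrableOn (fun z => u z * P f z) (Ω : Set ℂ) := fun f =>
    (hu.const_mul ‖D (P f)‖).mono' (hmul _) (Filter.Eventually.of_forall (hbd f))
  have hσc : Continuous σ := (σ.restrictScalars ℝ).continuous_of_finiteDimensional
  have hJrc : Continuous Jr := J.continuous.subtype_mk _
  have hPc : Continuous P := continuous_id.sub (hσc.comp hJrc)
  let T : 𝓓^{(n : ℕ∞)}(Ω, ℂ) →ₗ[ℂ] ℂ :=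
    { toFun f := ∫ z in (Ω : Set ℂ), u z * P f z
      map_add' f g := by
        rw [← integral_add (hint f) (hint g)]
        congr 1
        ext z
        rw [map_add, ← mul_add]
        rfl
      map_smul' c f := by
        rw [RingHom.id_apply, smul_eq_mul, ← integral_const_mul]
        congr 1
        ext z
        rw [map_smul, mul_left_comm]
        rfl }
  have hTb : ∀ f, ‖T f‖ ≤ ‖D (P f)‖ * ∫ z in (Ω : Set ℂ), ‖z‖ ^ n * ‖u z‖ := fun f => by
    rw [← integral_const_mul]
    exact norm_integral_le_of_norm_le (hu.const_mul _) (Filter.Eventually.of_forall (hbd f))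
  have hTc : Continuous T := by
    refine continuous_of_continuousAt_zero T ?_
    rw [ContinuousAt, map_zero]
    refine squeeze_zero_norm hTb ?_
    have h1 : Continuous fun f => ‖D (P f)‖ :=
      TestFunction.continuous_norm_bcf (D.continuous.comp hPc)
    have h2 : ‖D (P 0)‖ = 0 := by
      rw [map_zero, map_zero]
      exact norm_zero (E := BoundedContinuousFunction ℂ
        (ContinuousMultilinearMap ℝ (fun _ : Fin n => ℂ) ℂ))
    have h3 := (h1.tendsto 0).mul_const (∫ z in (Ω : Set ℂ), ‖z‖ ^ n * ‖u z‖)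
    rwa [h2, zero_mul] at h3
  -- `N` consists of the jets whose representative is already integrable against `u`. There the
  -- functional is forced to be the integral; on the rest of the finite-dimensional jet space any
  -- linear extension works.
  let N : Submodule ℂ J.toLinearMap.range :=
    { carrier := {e | IntegrableOn (fun z => u z * σ e z) (Ω : Set ℂ)}
      add_mem' := fun {e e'} he he' => by
        refine (he.add he').congr (Filter.Eventually.of_forall fun z => ?_)
        change u z * σ e z + u z * σ e' z = u z * σ (e + e') z
        rw [map_add, ← mul_add]
        rfl
      zero_mem' := by
        refine integrableOn_zero.congr (Filter.Eventually.of_forall fun z => ?_)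
        change 0 = u z * σ 0 z
        rw [map_zero]
        exact (mul_zero _).symm
      smul_mem' := fun c e he => by
        refine (he.const_mul c).congr (Filter.Eventually.of_forall fun z => ?_)
        change c * (u z * σ e z) = u z * σ (c • e) z
        rw [map_smul, mul_left_comm]
        rfl }
  let l0 : N →ₗ[ℂ] ℂ :=
    { toFun e := ∫ z in (Ω : Set ℂ), u z * σ e z
      map_add' e e' := by
        rw [← integral_add e.2 e'.2]
        congr 1
        ext z
        rw [Submodule.coe_add, map_add, ← mul_add]
        rfl
      map_smul' c e := by
        rw [RingHom.id_apply, smul_eq_mul, ← integral_const_mul]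
        congr 1
        ext z
        rw [Submodule.coe_smul, map_smul, mul_left_comm]
        rfl }
  obtain ⟨l, hl⟩ := LinearMap.exists_extend l0
  have hlc : Continuous l := l.continuous_of_finiteDimensional
  refine ⟨⟨T + l ∘ₗ Jr, hTc.add (hlc.comp hJrc)⟩, fun Φ hΦ => ?_⟩
  have hdec : ∀ z, u z * Φ z = u z * P Φ z + u z * σ (Jr Φ) z := fun z => by
    rw [← mul_add]
    congr 1
    change Φ z = Φ z - σ (Jr Φ) z + σ (Jr Φ) z
    ring
  -- If `u * Φ` is integrable, so is its difference with `u * P Φ`; hence the jet of `Φ` lies in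
  -- `N`.
  have hN : IntegrableOn (fun z => u z * σ (Jr Φ) z) (Ω : Set ℂ) := by
    refine (hΦ.sub (hint Φ)).congr (Filter.Eventually.of_forall fun z => ?_)
    simp [hdec]
  have hl' : l (Jr Φ) = ∫ z in (Ω : Set ℂ), u z * σ (Jr Φ) z :=
    LinearMap.congr_fun hl ⟨Jr Φ, hN⟩
  change T Φ + l (Jr Φ) = _
  rw [hl']
  simp_rw [hdec]
  exact (integral_add (hint Φ) hN).symm

/-! ### Periodic solutions of a first-order linear equation. -/

/-- The periodic solution of the linear equation `v' = i s h v + g` with periodic coefficients,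
when the monodromy is not trivial. -/
theorem exists_periodic_solution {h g : ℝ → ℂ} {T : ℝ} (hT : 0 < T) (hh : Continuous h)
    (hg : Continuous g) (hhp : Function.Periodic h T) (hgp : Function.Periodic g T) (s : ℂ)
    {H G : ℝ} (hH : ∀ θ, ‖h θ‖ ≤ H) (hG : ∀ θ, ‖g θ‖ ≤ G)
    (hne : 1 - Complex.exp (Complex.I * s * ∫ θ in (0 : ℝ)..T, h θ) ≠ 0) :
    ∃ v : ℝ → ℂ, Function.Periodic v T ∧
      (∀ θ, HasDerivAt v (Complex.I * s * h θ * v θ + g θ) θ) ∧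
      ∀ θ, ‖v θ‖ ≤ ‖1 - Complex.exp (Complex.I * s * ∫ θ in (0 : ℝ)..T, h θ)‖⁻¹ *
        (G * Real.exp (‖s‖ * (H * T)) * T) := by
  set Q : ℝ → ℂ := fun θ => ∫ φ in (0 : ℝ)..θ, h φ with hQdef
  have hQ : ∀ θ, HasDerivAt Q (h θ) θ := fun θ => (hh.integral_hasStrictDerivAt 0 θ).hasDerivAt
  have hQc : Continuous Q := continuous_iff_continuousAt.2 fun θ => (hQ θ).continuousAt
  have hQsub : ∀ θ φ, Q θ - Q φ = ∫ x in φ..θ, h x := fun θ φ =>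
    intervalIntegral.integral_interval_sub_left (hh.intervalIntegrable _ _)
      (hh.intervalIntegrable _ _)
  have hQT : ∀ θ, Q (θ + T) = Q θ + Q T := fun θ => by
    have h1 := hQsub (θ + T) θ
    rw [hhp.intervalIntegral_add_eq θ 0, zero_add] at h1
    rw [← sub_eq_iff_eq_add', h1]
  set M := Complex.exp (Complex.I * s * Q T) with hM
  set e : ℝ → ℂ := fun θ => Complex.exp (Complex.I * s * Q θ) with he
  set k : ℝ → ℂ := fun θ => Complex.exp (-(Complex.I * s * Q θ)) * g θ with hk
  have hkc : Continuous k := by fun_prop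
  have hek : ∀ θ, e θ * k θ = g θ := fun θ => by
    simp only [he, hk]
    rw [← mul_assoc, ← Complex.exp_add, add_neg_cancel, Complex.exp_zero, one_mul]
  have heT : ∀ θ, e (θ + T) = M * e θ := fun θ => by
    simp only [he, hM, hQT]
    rw [← Complex.exp_add]
    ring_nf
  have hkT : ∀ θ, M * k (θ + T) = k θ := fun θ => by
    simp only [hk, hM, hQT, hgp θ]
    rw [← mul_assoc, ← Complex.exp_add]
    ring_nf
  set F : ℝ → ℂ := fun θ => ∫ φ in (0 : ℝ)..θ, k φ with hF
  have hFd : ∀ θ, HasDerivAt F (k θ) θ := fun θ => (hkc.integral_hasStrictDerivAt 0 θ).hasDerivAt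
  have hFsub : ∀ θ φ, F θ - F φ = ∫ x in φ..θ, k x := fun θ φ =>
    intervalIntegral.integral_interval_sub_left (hkc.intervalIntegrable _ _)
      (hkc.intervalIntegrable _ _)
  have hed : ∀ θ, HasDerivAt e (e θ * (Complex.I * s * h θ)) θ := fun θ =>
    ((hQ θ).const_mul (Complex.I * s)).cexp
  -- Variation of constants over the period preceding `θ`. The factor `(1 - M)⁻¹` normalizes the
  -- forcing term, since `e θ * k (θ - T) = M * g θ`.
  refine ⟨fun θ => (1 - M)⁻¹ * (e θ * (F θ - F (θ - T))), fun θ => ?_, fun θ => ?_, fun θ => ?_⟩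
  · have h1 : M * (F (θ + T) - F θ) = F θ - F (θ - T) := by
      rw [hFsub, hFsub, ← intervalIntegral.integral_const_mul]
      have h2 := intervalIntegral.integral_comp_add_right (a := θ - T) (b := θ)
        (fun x => M * k x) T
      rw [sub_add_cancel] at h2
      rw [← h2]
      simp_rw [hkT]
    simp only [add_sub_cancel_right]
    rw [heT, ← h1]
    ring
  · have h1 : HasDerivAt (fun θ => F (θ - T)) (k (θ - T)) θ := (hFd (θ - T)).comp_sub_const θ T
    have h2 := ((hed θ).mul ((hFd θ).sub h1)).const_mul (1 - M)⁻¹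
    refine h2.congr_deriv ?_
    have h3 := hkT (θ - T)
    rw [sub_add_cancel] at h3
    rw [← h3]
    have h4 := hek θ
    simp only [Pi.sub_apply]
    calc _ = Complex.I * s * h θ * ((1 - M)⁻¹ * (e θ * (F θ - F (θ - T))))
          + (1 - M)⁻¹ * (1 - M) * (e θ * k θ) := by ring
      _ = _ := by rw [inv_mul_cancel₀ hne, h4, one_mul]
  · rw [norm_mul, norm_inv]
    gcongr
    -- Only differences `Q θ - Q φ` over at most one period enter, so the bound is uniform in `θ`.
    rw [hFsub, ← intervalIntegral.integral_const_mul]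
    have := intervalIntegral.norm_integral_le_of_norm_le_const (a := θ - T) (b := θ)
      (f := fun x => e θ * k x) (C := G * Real.exp (‖s‖ * (H * T))) fun φ hφ => ?_
    · rwa [sub_sub_cancel, abs_of_pos hT] at this
    · rw [Set.uIoc_of_le (by linarith)] at hφ
      have h1 : e θ * k φ = Complex.exp (Complex.I * s * (Q θ - Q φ)) * g φ := by
        simp only [he, hk]
        rw [← mul_assoc, ← Complex.exp_add]
        ring_nf
      have hH0 : 0 ≤ H := (norm_nonneg _).trans (hH 0)
      have h2 : ‖Q θ - Q φ‖ ≤ H * T := by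
        rw [hQsub]
        refine (intervalIntegral.norm_integral_le_of_norm_le_const fun x _ => hH x).trans ?_
        gcongr
        rw [abs_of_nonneg (by linarith [hφ.2])]
        linarith [hφ.1]
      rw [h1, norm_mul, mul_comm]
      have hG0 : 0 ≤ G := (norm_nonneg _).trans (hG 0)
      gcongr
      · exact hG φ
      · refine (Complex.norm_exp_le_exp_norm _).trans (Real.exp_le_exp.2 ?_)
        rw [norm_mul, norm_mul, Complex.norm_I, one_mul]
        gcongr

/-! ### Exponential series in logarithmic polar coordinates. -/

/-- The series `∑ j ^ m e ^ (j t) a j θ` in the logarithmic polar coordinates `t + i θ`. -/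
noncomputable def expSeries (a : ℕ → ℝ → ℂ) (m : ℕ) (ζ : ℂ) : ℂ :=
  ∑' j : ℕ, (j : ℂ) ^ m * Complex.exp (j * ζ.re) * a j ζ.im

theorem isOpen_re_lt (T : ℝ) : IsOpen {ζ : ℂ | ζ.re < T} :=
  isOpen_lt Complex.continuous_re continuous_const

theorem hasDerivAt_mk_re (t θ : ℝ) : HasDerivAt (fun t : ℝ => (⟨t, θ⟩ : ℂ)) 1 t := by
  simp_rw [Complex.mk_eq_add_mul_I]
  exact Complex.ofRealCLM.hasDerivAt.add_const _

namespace expSeries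

variable {a : ℕ → ℝ → ℂ} {D K T : ℝ}

/-- A majorant independent of `ζ` on the half-plane; when `K * exp T < 1` it is summable for every
polynomial weight `j ^ m`. -/
theorem norm_term_le (ha : ∀ j θ, ‖a j θ‖ ≤ D * K ^ j) (m j : ℕ) {ζ : ℂ}
    (hζ : ζ.re < T) :
    ‖(j : ℂ) ^ m * Complex.exp (j * ζ.re) * a j ζ.im‖ ≤
      D * ((j : ℝ) ^ m * (K * Real.exp T) ^ j) := by
  rw [norm_mul, norm_mul, norm_pow, Complex.norm_natCast, Complex.norm_exp]
  have h1 : ((j : ℂ) * (ζ.re : ℂ)).re = j * ζ.re := by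
    rw [Complex.re_mul_ofReal, Complex.natCast_re]
  have h2 : Real.exp (j * ζ.re) ≤ Real.exp T ^ j := by
    rw [← Real.exp_nat_mul]
    gcongr
  rw [h1]
  calc (j : ℝ) ^ m * Real.exp (j * ζ.re) * ‖a j ζ.im‖
      ≤ (j : ℝ) ^ m * Real.exp T ^ j * (D * K ^ j) := by
        gcongr
        exact ha j _
    _ = _ := by rw [mul_pow]; ring

theorem summable_bound (D : ℝ) (hK : 0 ≤ K) (hT : K * Real.exp T < 1) (m : ℕ) :
    Summable fun j : ℕ => D * ((j : ℝ) ^ m * (K * Real.exp T) ^ j) :=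
  (summable_pow_mul_geometric_of_norm_lt_one m (by
    rwa [Real.norm_of_nonneg (by positivity)])).mul_left D

theorem hasSum (ha : ∀ j θ, ‖a j θ‖ ≤ D * K ^ j) (hK : 0 ≤ K) (hT : K * Real.exp T < 1) (m : ℕ)
    {ζ : ℂ} (hζ : ζ.re < T) :
    HasSum (fun j : ℕ => (j : ℂ) ^ m * Complex.exp (j * ζ.re) * a j ζ.im) (expSeries a m ζ) :=
  (Summable.of_norm_bounded (summable_bound D hK hT m)
    fun j => norm_term_le ha m j hζ).hasSum

theorem norm_le (ha : ∀ j θ, ‖a j θ‖ ≤ D * K ^ j) (hK : 0 ≤ K) (hT : K * Real.exp T < 1) (m : ℕ)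
    {ζ : ℂ} (hζ : ζ.re < T) :
    ‖expSeries a m ζ‖ ≤ ∑' j : ℕ, D * ((j : ℝ) ^ m * (K * Real.exp T) ^ j) :=
  tsum_of_norm_bounded (summable_bound D hK hT m).hasSum fun j => norm_term_le ha m j hζ

theorem hasDerivAt_cexp_nat_mul (j : ℕ) (t : ℝ) :
    HasDerivAt (fun t : ℝ => Complex.exp (j * (t : ℂ))) (j * Complex.exp (j * (t : ℂ))) t := by
  have := ((Complex.ofRealCLM.hasDerivAt (x := t)).const_mul (j : ℂ)).cexp
  simpa [mul_comm] using this

theorem hasDerivAt_re (ha : ∀ j θ, ‖a j θ‖ ≤ D * K ^ j) (hK : 0 ≤ K) (hT : K * Real.exp T < 1)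
    (m : ℕ) {t : ℝ} (ht : t < T) (θ : ℝ) :
    HasDerivAt (fun t : ℝ => expSeries a m ⟨t, θ⟩) (expSeries a (m + 1) ⟨t, θ⟩) t := by
  refine hasDerivAt_tsum_of_isPreconnected (t := Set.Iio T) (y₀ := t) (y := t)
    (𝕜 := ℝ) (g := fun (j : ℕ) (t : ℝ) => (j : ℂ) ^ m * Complex.exp (j * (t : ℂ)) * a j θ)
    (g' := fun (j : ℕ) (t : ℝ) => (j : ℂ) ^ (m + 1) * Complex.exp (j * (t : ℂ)) * a j θ)
    (summable_bound D hK hT (m + 1)) isOpen_Iio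
    isPreconnected_Iio (fun j t _ => ?_) (fun j t ht => ?_) ht
    (hasSum (ζ := ⟨t, θ⟩) ha hK hT m ht).summable ht
  · refine (((hasDerivAt_cexp_nat_mul j t).const_mul ((j : ℂ) ^ m)).mul_const (a j θ)).congr_deriv ?_
    rw [pow_succ]
    ring
  · exact norm_term_le ha (m + 1) j (ζ := ⟨t, θ⟩) ht

/-- Raising the weight by one is the same as differentiating in `t`. This serves the forcing series,
whose sum of weight zero is known in closed form. -/
theorem contDiffOn_of_zero (ha : ∀ j θ, ‖a j θ‖ ≤ D * K ^ j) (hK : 0 ≤ K)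
    (hT : K * Real.exp T < 1) (h0 : ContDiffOn ℝ ∞ (expSeries a 0) {ζ | ζ.re < T}) (m : ℕ) :
    ContDiffOn ℝ ∞ (expSeries a m) {ζ | ζ.re < T} := by
  induction m with
  | zero => exact h0
  | succ m ih =>
    have h1 : ContDiffOn ℝ ∞ (fun ζ => fderiv ℝ (expSeries a m) ζ 1) {ζ | ζ.re < T} :=
      (ih.fderiv_of_isOpen (isOpen_re_lt T) (by simp)).clm_apply contDiffOn_const
    refine h1.congr fun ζ hζ => ?_
    have h2 : HasFDerivAt (expSeries a m) (fderiv ℝ (expSeries a m) ζ) ζ :=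
      ((ih.contDiffAt ((isOpen_re_lt T).mem_nhds hζ)).differentiableAt (by simp)).hasFDerivAt
    exact (hasDerivAt_re ha hK hT m hζ ζ.im).unique
      (HasFDerivAt.comp_hasDerivAt (f := fun t : ℝ => (⟨t, ζ.im⟩ : ℂ)) ζ.re h2
        (hasDerivAt_mk_re ζ.re ζ.im))

variable {v c : ℕ → ℝ → ℂ} {h : ℝ → ℂ} {α : ℂ} {H : ℝ}

/-- The derivative of a series whose coefficients solve
`v j' = i (j + α) h v j + c j`. -/
theorem hasFDerivAt (hv : ∀ j θ, ‖v j θ‖ ≤ D * K ^ j) (hc : ∀ j θ, ‖c j θ‖ ≤ D * K ^ j)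
    (hK : 0 ≤ K) (hT : K * Real.exp T < 1) (hH : ∀ θ, ‖h θ‖ ≤ H)
    (hode : ∀ j θ, HasDerivAt (v j) (Complex.I * (j + α) * h θ * v j θ + c j θ) θ)
    (m : ℕ) {ζ : ℂ} (hζ : ζ.re < T) :
    HasFDerivAt (expSeries v m)
      (Complex.reCLM.smulRight (expSeries v (m + 1) ζ) +
        Complex.imCLM.smulRight (Complex.I * h ζ.im *
          (expSeries v (m + 1) ζ + α * expSeries v m ζ) + expSeries c m ζ)) ζ := by
  have hconv : Convex ℝ {ζ : ℂ | ζ.re < T} := convex_halfSpace_re_lt T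
  set t : (ℕ → ℝ → ℂ) → ℕ → ℕ → ℂ → ℂ :=
    fun a m j ζ => (j : ℂ) ^ m * Complex.exp (j * ζ.re) * a j ζ.im with ht
  -- `y j` is the `θ`-derivative of the term, rewritten by the differential equation; the factor `j`
  -- becomes the weight `m + 1`.
  set y : ℕ → ℂ → ℂ := fun j ζ => Complex.I * h ζ.im * (t v (m + 1) j ζ + α * t v m j ζ) + t c m j ζ
    with hy
  have hD : ∀ j ζ, HasFDerivAt (t v m j)
      (Complex.reCLM.smulRight (t v (m + 1) j ζ) + Complex.imCLM.smulRight (y j ζ)) ζ := by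
    intro j ζ
    have h1 := (HasFDerivAt.comp (f := Complex.reCLM) ζ
      (hasDerivAt_cexp_nat_mul j (Complex.reCLM ζ)).hasFDerivAt
      Complex.reCLM.hasFDerivAt).const_mul ((j : ℂ) ^ m)
    have h2 := HasFDerivAt.comp (f := Complex.imCLM) ζ (hode j (Complex.imCLM ζ)).hasFDerivAt
      Complex.imCLM.hasFDerivAt
    refine (h1.mul h2).congr_fderiv ?_
    ext x
    simp [hy, ht]
    ring
  have hbd : ∀ j ζ, ζ.re < T →
      ‖Complex.reCLM.smulRight (t v (m + 1) j ζ) + Complex.imCLM.smulRight (y j ζ)‖ ≤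
      D * ((j : ℝ) ^ (m + 1) * (K * Real.exp T) ^ j) +
      (H * (D * ((j : ℝ) ^ (m + 1) * (K * Real.exp T) ^ j) +
        ‖α‖ * (D * ((j : ℝ) ^ m * (K * Real.exp T) ^ j))) +
        D * ((j : ℝ) ^ m * (K * Real.exp T) ^ j)) := by
    intro j ζ hζ
    have b1 := norm_term_le hv (m + 1) j hζ
    have b2 := norm_term_le hv m j hζ
    have b3 := norm_term_le hc m j hζ
    have hH0 : 0 ≤ H := (norm_nonneg _).trans (hH 0)
    refine (norm_add_le _ _).trans (add_le_add ?_ ?_)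
    · rw [ContinuousLinearMap.norm_smulRight_apply, Complex.reCLM_norm, one_mul]
      exact b1
    · rw [ContinuousLinearMap.norm_smulRight_apply, Complex.imCLM_norm, one_mul]
      refine (norm_add_le _ _).trans (add_le_add ?_ b3)
      rw [norm_mul, norm_mul, Complex.norm_I, one_mul]
      gcongr
      · exact hH _
      · refine (norm_add_le _ _).trans (add_le_add b1 ?_)
        rw [norm_mul]
        gcongr
  have hsum := ((summable_bound D hK hT (m + 1)).add
    ((((summable_bound D hK hT (m + 1)).add ((summable_bound D hK hT m).mul_left ‖α‖)).mul_left
      H).add (summable_bound D hK hT m)))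
  have key := hasFDerivAt_tsum_of_isPreconnected hsum (isOpen_re_lt T) hconv.isPreconnected
    (fun j ζ _ => hD j ζ) hbd hζ (hasSum hv hK hT m hζ).summable hζ
  refine key.congr_fderiv (HasSum.tsum_eq ?_)
  have s1 := hasSum hv hK hT (m + 1) hζ
  have s2 := hasSum hv hK hT m hζ
  have s3 := hasSum hc hK hT m hζ
  exact (((ContinuousLinearMap.smulRightL ℝ ℂ ℂ Complex.reCLM).hasSum s1)).add
    ((ContinuousLinearMap.smulRightL ℝ ℂ ℂ Complex.imCLM).hasSum
      (((s1.add (s2.mul_left α)).mul_left (Complex.I * h ζ.im)).add s3))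

/-- Regularity of the series is gained by exchanging derivatives in `θ` for derivatives in `t`. -/
theorem contDiffOn (hv : ∀ j θ, ‖v j θ‖ ≤ D * K ^ j) (hc : ∀ j θ, ‖c j θ‖ ≤ D * K ^ j)
    (hK : 0 ≤ K) (hT : K * Real.exp T < 1) (hH : ∀ θ, ‖h θ‖ ≤ H) (hh : ContDiff ℝ ∞ h)
    (hode : ∀ j θ, HasDerivAt (v j) (Complex.I * (j + α) * h θ * v j θ + c j θ) θ)
    (h0 : ContDiffOn ℝ ∞ (expSeries c 0) {ζ | ζ.re < T}) (m : ℕ) :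
    ContDiffOn ℝ ∞ (expSeries v m) {ζ | ζ.re < T} := by
  have hder := fun m ζ hζ => hasFDerivAt (ζ := ζ) hv hc hK hT hH hode m hζ
  refine contDiffOn_infty.2 fun n => ?_
  -- All `m` are treated together: each derivative lowers `n` by one but involves the weight `m +
  -- 1`.
  induction n generalizing m with
  | zero =>
    exact contDiffOn_zero.2 fun ζ hζ => (hder m ζ hζ).continuousAt.continuousWithinAt
  | succ n ih =>
    rw [show ((n + 1 : ℕ) : WithTop ℕ∞) = n + 1 by norm_cast]
    rw [contDiffOn_succ_iff_fderiv_of_isOpen (isOpen_re_lt T)]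
    refine ⟨fun ζ hζ => (hder m ζ hζ).differentiableAt.differentiableWithinAt, by simp, ?_⟩
    rw [contDiffOn_clm_apply]
    intro x
    have hF : ContDiffOn ℝ n (expSeries c m) {ζ | ζ.re < T} :=
      contDiffOn_infty.1 (contDiffOn_of_zero hc hK hT h0 m) n
    have hhn : ContDiffOn ℝ n (fun ζ : ℂ => h ζ.im) {ζ | ζ.re < T} :=
      ((contDiff_infty.1 hh n).comp Complex.imCLM.contDiff).contDiffOn
    have h1 : ContDiffOn ℝ n (fun ζ => x.re • expSeries v (m + 1) ζ +
        x.im • (Complex.I * h ζ.im * (expSeries v (m + 1) ζ + α * expSeries v m ζ)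
          + expSeries c m ζ)) {ζ | ζ.re < T} :=
      ((ih (m + 1)).const_smul x.re).add ((((contDiffOn_const.mul hhn).mul
        ((ih (m + 1)).add (contDiffOn_const.mul (ih m)))).add hF).const_smul x.im)
    refine h1.congr fun ζ hζ => ?_
    rw [(hder m ζ hζ).fderiv]
    rfl

end expSeries

/-! ### The divergence theorem with an exceptional point. -/

open MeasureTheory in
/-- The divergence theorem for a compactly supported continuous vector field on the plane which is
differentiable outside the origin. -/
theorem integral_divergence_eq_zero {G₁ G₂ φ : ℂ → ℂ} {R : ℝ} (hc₁ : Continuous G₁)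
    (hc₂ : Continuous G₂) (hd₁ : ∀ z ≠ 0, DifferentiableAt ℝ G₁ z)
    (hd₂ : ∀ z ≠ 0, DifferentiableAt ℝ G₂ z) (hs₁ : ∀ z, R ≤ ‖z‖ → G₁ z = 0)
    (hs₂ : ∀ z, R ≤ ‖z‖ → G₂ z = 0)
    (hφ : ∀ z ≠ 0, fderiv ℝ G₁ z 1 + fderiv ℝ G₂ z Complex.I = φ z) (hi : Integrable φ) :
    ∫ z, φ z = 0 := by
  let e : ℝ × ℝ →L[ℝ] ℂ := (Complex.equivRealProdCLM.symm : ℝ × ℝ →L[ℝ] ℂ)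
  have he : ∀ p : ℝ × ℝ, e p = ⟨p.1, p.2⟩ := fun p => by
    apply Complex.ext <;> simp [e]
  have he0 : ∀ p : ℝ × ℝ, p ≠ 0 → e p ≠ 0 := fun p hp h => hp (by
    rw [he] at h
    exact Prod.ext (congrArg Complex.re h) (congrArg Complex.im h))
  have hmp := Complex.volume_preserving_equiv_real_prod.symm
  have hme : ⇑Complex.measurableEquivRealProd.symm = e := by
    funext p
    rw [he]
    rfl
  -- The square of half-side `r` has its boundary outside the support, so all boundary terms vanish.
  let r : ℝ := |R| + 1
  have hr : 0 < r := by positivity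
  have hRr : R < r := (le_abs_self R).trans_lt (lt_add_one _)
  have hvan : ∀ p : ℝ × ℝ, r ≤ |p.1| ∨ r ≤ |p.2| → r ≤ ‖e p‖ := fun p hp => by
    rw [he]
    rcases hp with hp | hp
    · exact hp.trans (Complex.abs_re_le_norm ⟨p.1, p.2⟩)
    · exact hp.trans (Complex.abs_im_le_norm ⟨p.1, p.2⟩)
  have hφ0 : ∀ z, r ≤ ‖z‖ → φ z = 0 := fun z hz => by
    have hz0 : z ≠ 0 := norm_pos_iff.1 (hr.trans_le hz)
    have hU : {w : ℂ | R < ‖w‖} ∈ nhds z :=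
      (isOpen_lt continuous_const continuous_norm).mem_nhds (hRr.trans_le hz)
    have h1 : G₁ =ᶠ[nhds z] fun _ => 0 := by
      filter_upwards [hU] with w hw using hs₁ w (le_of_lt hw)
    have h2 : G₂ =ᶠ[nhds z] fun _ => 0 := by
      filter_upwards [hU] with w hw using hs₂ w (le_of_lt hw)
    rw [← hφ z hz0, h1.fderiv_eq, h2.fderiv_eq]
    simp
  have hie : Integrable (fun p => φ (e p)) := by
    rw [← hme]
    exact (hmp.integrable_comp_emb (MeasurableEquiv.measurableEmbedding _)).2 hi
  have hint : ∫ z, φ z = ∫ p, φ (e p) := by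
    rw [← hme]
    exact (hmp.integral_comp' _).symm
  have hae : (fun p : ℝ × ℝ => ((fderiv ℝ G₁ (e p)).comp e) (1, 0) +
      ((fderiv ℝ G₂ (e p)).comp e) (0, 1)) =ᵐ[volume] fun p => φ (e p) := by
    have h0 : ∀ᵐ p : ℝ × ℝ, p ≠ 0 := by
      simp [ae_iff]
    filter_upwards [h0] with p hp
    rw [← hφ _ (he0 p hp), ContinuousLinearMap.comp_apply, ContinuousLinearMap.comp_apply, he, he]
    rfl
  have key := integral_divergence_prod_Icc_of_hasFDerivAt_off_countable_of_le
    (fun p => G₁ (e p)) (fun p => G₂ (e p))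
    (fun p => (fderiv ℝ G₁ (e p)).comp e) (fun p => (fderiv ℝ G₂ (e p)).comp e)
    (-r, -r) (r, r) (Prod.mk_le_mk.2 ⟨by linarith, by linarith⟩) {0} (Set.countable_singleton _)
    (hc₁.comp e.continuous).continuousOn (hc₂.comp e.continuous).continuousOn
    (fun p hp => (hd₁ _ (he0 p hp.2)).hasFDerivAt.comp p e.hasFDerivAt)
    (fun p hp => (hd₂ _ (he0 p hp.2)).hasFDerivAt.comp p e.hasFDerivAt)
    (hie.congr hae.symm).integrableOn
  rw [setIntegral_congr_ae measurableSet_Icc (hae.mono fun p hp _ => hp)] at key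
  have hz₁ : ∀ p : ℝ × ℝ, r ≤ |p.1| ∨ r ≤ |p.2| → G₁ (e p) = 0 :=
    fun p hp => hs₁ _ (hRr.le.trans (hvan p hp))
  have hz₂ : ∀ p : ℝ × ℝ, r ≤ |p.1| ∨ r ≤ |p.2| → G₂ (e p) = 0 :=
    fun p hp => hs₂ _ (hRr.le.trans (hvan p hp))
  have habs : r ≤ |r| := le_abs_self r
  rw [hint, ← setIntegral_eq_integral_of_forall_compl_eq_zero (s := Set.Icc (-r, -r) (r, r)), key]
  · simp [hz₁, hz₂, habs]
  · intro p hp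
    refine hφ0 _ (hvan p ?_)
    by_contra! hcon
    refine hp ⟨⟨?_, ?_⟩, ⟨?_, ?_⟩⟩
    exacts [(abs_lt.1 hcon.1).1.le, (abs_lt.1 hcon.2).1.le, (abs_lt.1 hcon.1).2.le,
      (abs_lt.1 hcon.2).2.le]

/-! ### Homogeneous expansion and coefficients of the formal solution. -/

/-- The expansion of a real analytic function into homogeneous polynomials. -/
theorem AnalyticAt.exists_homogeneous_expansion {f : ℂ → ℂ} (hf : AnalyticAt ℝ f 0) :
    ∃ r > 0, AnalyticOnNhd ℝ f (Metric.ball 0 r) ∧ ∃ F : ℕ → ℂ → ℂ, (∀ j, Continuous (F j)) ∧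
      (∀ j (t : ℝ) z, F j (t * z) = (t : ℂ) ^ j * F j z) ∧
      (∃ C K : ℝ, 0 < C ∧ 0 < K ∧ ∀ j z, ‖z‖ = 1 → ‖F j z‖ ≤ C * K ^ j) ∧
      ∀ z ∈ Metric.ball (0 : ℂ) r, HasSum (fun j => F j z) (f z) := by
  obtain ⟨p, R, hp⟩ := hf
  obtain ⟨r, hr0, hrR⟩ := ENNReal.lt_iff_exists_nnreal_btwn.1 hp.r_pos
  have hr0' : 0 < r := by exact_mod_cast hr0
  obtain ⟨C, hC, hb⟩ := p.norm_le_div_pow_of_pos_of_lt_radius hr0' (hrR.trans_le hp.r_le)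
  have hsub : Metric.ball (0 : ℂ) r ⊆ Metric.eball 0 R := by
    rw [← Metric.eball_coe]
    exact Metric.eball_subset_eball hrR.le
  refine ⟨r, hr0', hp.analyticOnNhd.mono hsub, fun j z => p j fun _ => z,
    fun j => (p j).cont.comp (continuous_pi fun _ => continuous_id), fun j t z => ?_,
    ⟨C, (r : ℝ)⁻¹, hC, by positivity, fun j z hz => ?_⟩, fun z hz => ?_⟩
  · have := (p j).map_smul_univ (fun _ => t) (fun _ => z)
    simpa [Complex.real_smul] using this
  · refine ((p j).le_opNorm _).trans ?_
    simpa [hz, div_eq_mul_inv] using hb j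
  · simpa using hp.hasSum (hsub hz)

theorem Function.Periodic.exists_norm_le {g : ℝ → ℂ} {T : ℝ} (hT : 0 < T)
    (hp : Function.Periodic g T) (hg : Continuous g) : ∃ C, ∀ θ, ‖g θ‖ ≤ C := by
  obtain ⟨C, hC⟩ := (isCompact_Icc (a := 0) (b := T)).exists_bound_of_continuousOn hg.continuousOn
  refine ⟨C, fun θ => ?_⟩
  obtain ⟨y, hy, hyθ⟩ := hp.exists_mem_Ico₀ hT θ
  rw [hyθ]
  exact hC y ⟨hy.1, hy.2.le⟩

namespace HomogeneousVectorField

variable {lam : ℂ} (L : HomogeneousVectorField lam)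

theorem contDiff_circle {g : ℂ → ℂ} (hg : ContDiffOn ℝ ∞ g {0}ᶜ) :
    ContDiff ℝ ∞ fun θ : ℝ => g (Complex.exp (θ * Complex.I)) := by
  have h1 : ContDiff ℝ ∞ fun θ : ℝ => Complex.exp (θ * Complex.I) :=
    (Complex.ofRealCLM.contDiff.mul contDiff_const).cexp
  exact hg.comp_contDiff h1 fun θ => Complex.exp_ne_zero _

theorem contDiff_ofReal_cos : ContDiff ℝ ∞ fun θ : ℝ => (Real.cos θ : ℂ) :=
  Complex.ofRealCLM.contDiff.comp Real.contDiff_cos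

theorem contDiff_ofReal_sin : ContDiff ℝ ∞ fun θ : ℝ => (Real.sin θ : ℂ) :=
  Complex.ofRealCLM.contDiff.comp Real.contDiff_sin

theorem contDiff_p : ContDiff ℝ ∞ L.p :=
  ((contDiff_circle L.smooth_B).mul contDiff_ofReal_cos).sub
    ((contDiff_circle L.smooth_A).mul contDiff_ofReal_sin)

theorem contDiff_q : ContDiff ℝ ∞ L.q :=
  contDiff_const.mul (((contDiff_circle L.smooth_A).mul contDiff_ofReal_cos).add
    ((contDiff_circle L.smooth_B).mul contDiff_ofReal_sin))

theorem periodic_circle : Function.Periodic (fun θ : ℝ => Complex.exp (θ * Complex.I))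
    (2 * Real.pi) := fun θ => by
  push_cast
  rw [add_mul, Complex.exp_add, Complex.exp_two_pi_mul_I, mul_one]

theorem periodic_p : Function.Periodic L.p (2 * Real.pi) := fun θ => by
  have := periodic_circle θ
  simp only at this
  simp only [p, this, Real.cos_add_two_pi, Real.sin_add_two_pi]

theorem periodic_q : Function.Periodic L.q (2 * Real.pi) := fun θ => by
  have := periodic_circle θ
  simp only at this
  simp only [q, this, Real.cos_add_two_pi, Real.sin_add_two_pi]

variable {L}

theorem CondC2.p_ne_zero (hC2 : L.CondC2) (θ : ℝ) : L.p θ ≠ 0 := by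
  have h := hC2 (Complex.exp (θ * Complex.I)) (Complex.exp_ne_zero _)
  rw [Complex.exp_ofReal_mul_I_re, Complex.exp_ofReal_mul_I_im] at h
  intro h0
  apply h
  rw [p] at h0
  linear_combination -h0

/-- The coefficients of the formal solution of `L u = f`. -/
theorem exists_coefficients (hC2 : L.CondC2) (hDC : DiophantineDC L.mu lam) {c : ℕ → ℝ → ℂ}
    (hcc : ∀ j, Continuous (c j)) (hcp : ∀ j, Function.Periodic (c j) (2 * Real.pi)) {C K : ℝ}
    (hC : 0 < C) (hK : 0 < K) (hc : ∀ j θ, ‖c j θ‖ ≤ C * K ^ j) :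
    ∃ (v : ℕ → ℝ → ℂ) (D K' : ℝ), 0 ≤ K' ∧ (∀ j, Function.Periodic (v j) (2 * Real.pi)) ∧
      (∀ j θ, HasDerivAt (v j)
        (Complex.I * (j + (1 - lam)) * (L.q θ / L.p θ) * v j θ + c j θ) θ) ∧
      (∀ j θ, ‖v j θ‖ ≤ D * K' ^ j) ∧ ∀ j θ, ‖c j θ‖ ≤ D * K' ^ j := by
  have hpi : 0 < 2 * Real.pi := Real.two_pi_pos
  have hhc : Continuous fun θ => L.q θ / L.p θ :=
    L.contDiff_q.continuous.div L.contDiff_p.continuous hC2.p_ne_zero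
  have hhp : Function.Periodic (fun θ => L.q θ / L.p θ) (2 * Real.pi) := fun θ => by
    simp only [L.periodic_q θ, L.periodic_p θ]
  obtain ⟨H, hH⟩ := hhp.exists_norm_le hpi hhc
  have hH0 : 0 ≤ H := (norm_nonneg _).trans (hH 0)
  obtain ⟨δ, hδ, hδj⟩ := hDC
  -- Since `j + (1 - lam) = (j + 1) - lam`, the Diophantine bound is used at `j + 1`, which covers
  -- the term `j = 0`.
  have hM : ∀ j : ℕ, δ ^ (j + 1) ≤ ‖1 - Complex.exp (Complex.I * ((j : ℂ) + (1 - lam)) *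
      ∫ θ in (0 : ℝ)..(2 * Real.pi), L.q θ / L.p θ)‖ := fun j => by
    refine (hδj (j + 1) (by omega)).trans (le_of_eq ?_)
    congr 3
    rw [mu]
    have : (Real.pi : ℂ) ≠ 0 := by exact_mod_cast Real.pi_ne_zero
    field_simp
    push_cast
    ring
  have hex := fun j : ℕ => exists_periodic_solution hpi hhc (hcc j) hhp (hcp j)
    ((j : ℂ) + (1 - lam)) hH (hc j) (norm_pos_iff.1 ((pow_pos hδ _).trans_le (hM j)))
  choose v hvp hvd hvb using hex
  -- The small divisor, the size of `c j` and the exponential of a quantity linear in `j` each grow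
  -- at most geometrically.
  have hv : ∀ j θ, ‖v j θ‖ ≤ (δ⁻¹ * C * Real.exp (‖1 - lam‖ * (H * (2 * Real.pi))) *
      (2 * Real.pi)) * (δ⁻¹ * K * Real.exp (H * (2 * Real.pi))) ^ j := fun j θ => by
    refine (hvb j θ).trans ?_
    have h1 : ‖(j : ℂ) + (1 - lam)‖ ≤ j + ‖1 - lam‖ :=
      (norm_add_le _ _).trans (by rw [Complex.norm_natCast])
    calc _ ≤ (δ ^ (j + 1))⁻¹ * (C * K ^ j * Real.exp ((j + ‖1 - lam‖) * (H * (2 * Real.pi))) *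
          (2 * Real.pi)) := by
          gcongr
          exact hM j
      _ = _ := by
          rw [add_mul, Real.exp_add, mul_pow, mul_pow, ← Real.exp_nat_mul, inv_pow, pow_succ,
            mul_inv]
          ring
  refine ⟨v, max (δ⁻¹ * C * Real.exp (‖1 - lam‖ * (H * (2 * Real.pi))) * (2 * Real.pi)) C,
    max (δ⁻¹ * K * Real.exp (H * (2 * Real.pi))) K, by positivity, hvp, fun j θ => hvd j θ,
    fun j θ => (hv j θ).trans ?_, fun j θ => (hc j θ).trans ?_⟩
  · gcongr
    · exact le_max_left _ _
    · exact le_max_left _ _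
  · gcongr
    · exact le_max_right _ _
    · exact le_max_right _ _

end HomogeneousVectorField

/-! ### From logarithmic coordinates back to the plane. -/

section LogarithmicCoordinates

variable {W : ℂ → ℂ}

theorem apply_log_exp_of_periodic (hper : Function.Periodic W (2 * Real.pi * Complex.I)) (ζ : ℂ) :
    W (Complex.log (Complex.exp ζ)) = W ζ := by
  have h : Complex.exp (Complex.log (Complex.exp ζ)) = Complex.exp ζ :=
    Complex.exp_log (Complex.exp_ne_zero ζ)
  obtain ⟨n, hn⟩ := Complex.exp_eq_exp_iff_exists_int.1 h
  rw [hn]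
  exact hper.int_mul n ζ

/-- Near `z` the branch `log (x / z) + log z` is smooth even when `z` lies on the cut of the
principal logarithm; periodicity of `W` makes the choice of branch immaterial. -/
theorem contDiffAt_comp_log (hper : Function.Periodic W (2 * Real.pi * Complex.I)) {z : ℂ}
    (hz : z ≠ 0) (hW : ContDiffAt ℝ ∞ W (Complex.log z)) :
    ContDiffAt ℝ ∞ (fun z => W (Complex.log z)) z := by
  have h1 : ContDiffAt ℝ ∞ (fun x => Complex.log (x / z) + Complex.log z) z := by
    have : ContDiffAt ℂ ∞ (fun x => Complex.log (x / z) + Complex.log z) z :=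
      (ContDiffAt.comp z (g := Complex.log) (f := fun x => x / z)
        (Complex.contDiffAt_log (by simp [hz])) (contDiffAt_id.div_const z)).add contDiffAt_const
    exact this.restrict_scalars ℝ
  have h2 : ContDiffAt ℝ ∞ (fun x => W (Complex.log (x / z) + Complex.log z)) z := by
    refine ContDiffAt.comp z (g := W) ?_ h1
    simpa [hz] using hW
  refine h2.congr_of_eventuallyEq ?_
  filter_upwards [isOpen_compl_singleton.mem_nhds (show z ∈ ({0}ᶜ : Set ℂ) from hz)] with x hx
  rw [← apply_log_exp_of_periodic hper (Complex.log (x / z) + _), Complex.exp_add,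
    Complex.exp_log (div_ne_zero hx hz), Complex.exp_log hz, div_mul_cancel₀ _ hz]

end LogarithmicCoordinates

theorem Real.ofReal_exp_cpow (t : ℝ) (s : ℂ) :
    ((Real.exp t : ℝ) : ℂ) ^ s = Complex.exp (s * t) := by
  rw [Complex.cpow_def_of_ne_zero (by exact_mod_cast (Real.exp_pos t).ne'),
    ← Complex.ofReal_log (Real.exp_pos t).le, Real.log_exp, mul_comm]

theorem Complex.exp_eq_ofReal_exp_mul (ζ : ℂ) :
    Complex.exp ζ = (Real.exp ζ.re : ℝ) * Complex.exp (ζ.im * Complex.I) := by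
  rw [Complex.ofReal_exp, ← Complex.exp_add, Complex.re_add_im]

theorem differentiableAt_ofReal_norm_cpow (s : ℂ) {z : ℂ} (hz : z ≠ 0) :
    DifferentiableAt ℝ (fun z : ℂ => (‖z‖ : ℂ) ^ s) z := by
  have h1 : DifferentiableAt ℝ (fun z : ℂ => (‖z‖ : ℂ)) z :=
    Complex.ofRealCLM.differentiableAt.comp z (differentiableAt_id.norm ℝ hz)
  have h2 : DifferentiableAt ℂ (fun x : ℂ => x ^ s) (‖z‖ : ℂ) :=
    differentiableAt_id.cpow_const (Or.inl (by simpa using hz))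
  exact (h2.restrictScalars ℝ).comp z h1

theorem differentiableAt_div_ofReal_norm_cpow {w : ℂ → ℂ} (s : ℂ) {z : ℂ} (hz : z ≠ 0)
    (hw : DifferentiableAt ℝ w z) : DifferentiableAt ℝ (fun z => w z / (‖z‖ : ℂ) ^ s) z := by
  have h := hw.mul (differentiableAt_ofReal_norm_cpow (-s) hz)
  refine h.congr_of_eventuallyEq (Filter.Eventually.of_forall fun x => ?_)
  simp only [Pi.mul_apply]
  rw [Complex.cpow_neg, div_eq_mul_inv]

namespace HomogeneousVectorField

variable {lam : ℂ} {L : HomogeneousVectorField lam}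

/-- The equation `L u = f` in the logarithmic polar coordinates `ζ = t + i θ`, where
`u = w / r ^ (lam - 1)` and `W ζ = w (e ^ ζ)`. -/
theorem apply_fderiv_of_log {w W : ℂ → ℂ} {ζ Wt Wθ F : ℂ} (hC2 : L.CondC2)
    (hw : DifferentiableAt ℝ w (Complex.exp ζ)) (hwW : ∀ ζ, w (Complex.exp ζ) = W ζ)
    (hW : HasFDerivAt W (Complex.reCLM.smulRight Wt + Complex.imCLM.smulRight Wθ) ζ)
    (heq : Wθ = Complex.I * (L.q ζ.im / L.p ζ.im) * (Wt + (1 - lam) * W ζ) + F / L.p ζ.im) :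
    L.A (Complex.exp ζ) * fderiv ℝ (fun z => w z / (‖z‖ : ℂ) ^ (lam - 1)) (Complex.exp ζ) 1 +
      L.B (Complex.exp ζ) *
        fderiv ℝ (fun z => w z / (‖z‖ : ℂ) ^ (lam - 1)) (Complex.exp ζ) Complex.I = F := by
  set u : ℂ → ℂ := fun z => w z / (‖z‖ : ℂ) ^ (lam - 1) with hu
  have hz : Complex.exp ζ ≠ 0 := Complex.exp_ne_zero ζ
  have hud : DifferentiableAt ℝ u (Complex.exp ζ) :=
    differentiableAt_div_ofReal_norm_cpow _ hz hw
  have hU : ∀ ζ, u (Complex.exp ζ) = Complex.exp ((1 - lam) * ζ.re) * W ζ := fun ζ => by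
    simp only [hu]
    rw [hwW, Complex.norm_exp, Real.ofReal_exp_cpow, div_eq_mul_inv, ← Complex.exp_neg, mul_comm]
    ring_nf
  have hre : HasFDerivAt (fun ζ : ℂ => (ζ.re : ℂ)) (Complex.ofRealCLM.comp Complex.reCLM) ζ :=
    (Complex.ofRealCLM.comp Complex.reCLM).hasFDerivAt
  have hU1 : HasFDerivAt (fun ζ => u (Complex.exp ζ)) _ ζ :=
    (((hre.const_mul (1 - lam)).cexp).mul hW).congr_of_eventuallyEq
      (Filter.Eventually.of_forall hU)
  have hexp : HasFDerivAt Complex.exp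
      ((ContinuousLinearMap.mul ℝ ℂ (Complex.exp ζ))) ζ := by
    have := (Complex.hasDerivAt_exp ζ).hasFDerivAt.restrictScalars ℝ
    refine this.congr_fderiv ?_
    ext x
    simp [mul_comm]
  have hU2 : HasFDerivAt (fun ζ => u (Complex.exp ζ)) _ ζ := hud.hasFDerivAt.comp ζ hexp
  -- Compare two derivatives of `u (e ^ ζ)`: the chain rule, and the explicit formula `hU`.
  have hx : ∀ x : ℂ, fderiv ℝ u (Complex.exp ζ) (Complex.exp ζ * x) =
      Complex.exp ((1 - lam) * ζ.re) * (x.re * (Wt + (1 - lam) * W ζ) + x.im * Wθ) := fun x => by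
    have := DFunLike.congr_fun (hU2.unique hU1) x
    simp at this
    rw [this]
    ring
  set c := Real.cos ζ.im with hc
  set s := Real.sin ζ.im with hs
  set E := Real.exp ζ.re with hE
  have hE0 : E ≠ 0 := (Real.exp_pos _).ne'
  have hcs : c ^ 2 + s ^ 2 = 1 := Real.cos_sq_add_sin_sq _
  have hzE : Complex.exp ζ = ⟨E * c, E * s⟩ := by
    apply Complex.ext
    · exact Complex.exp_re ζ
    · exact Complex.exp_im ζ
  -- The vectors `e ^ (-ζ)` and `i e ^ (-ζ)` are those that the differential of `exp` sends to `∂x`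
  -- and `∂y`.
  have e1 : Complex.exp ζ * ⟨E⁻¹ * c, -(E⁻¹ * s)⟩ = 1 := by
    rw [hzE]
    apply Complex.ext
    · simp
      field_simp
      linarith
    · simp
      ring
  have e2 : Complex.exp ζ * ⟨E⁻¹ * s, E⁻¹ * c⟩ = Complex.I := by
    rw [hzE]
    apply Complex.ext
    · simp
      ring
    · simp
      field_simp
      linarith
  have f1 := hx ⟨E⁻¹ * c, -(E⁻¹ * s)⟩
  have f2 := hx ⟨E⁻¹ * s, E⁻¹ * c⟩
  rw [e1] at f1
  rw [e2] at f2
  have hA : L.A (Complex.exp ζ) =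
      Complex.exp (lam * ζ.re) * L.A (Complex.exp (ζ.im * Complex.I)) := by
    rw [Complex.exp_eq_ofReal_exp_mul, L.homog_A _ (Real.exp_pos _), Real.ofReal_exp_cpow]
  have hB : L.B (Complex.exp ζ) =
      Complex.exp (lam * ζ.re) * L.B (Complex.exp (ζ.im * Complex.I)) := by
    rw [Complex.exp_eq_ofReal_exp_mul, L.homog_B _ (Real.exp_pos _), Real.ofReal_exp_cpow]
  have hexps : Complex.exp (lam * ζ.re) * Complex.exp ((1 - lam) * ζ.re) * (E : ℂ)⁻¹ = 1 := by
    rw [hE, Complex.ofReal_exp, ← Complex.exp_neg, ← Complex.exp_add, ← Complex.exp_add]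
    ring_nf
    exact Complex.exp_zero
  have hp := hC2.p_ne_zero ζ.im
  have hpdef : L.p ζ.im = L.B (Complex.exp (ζ.im * Complex.I)) * c
    - L.A (Complex.exp (ζ.im * Complex.I)) * s := rfl
  have hqdef : L.q ζ.im = Complex.I * (L.A (Complex.exp (ζ.im * Complex.I)) * c
    + L.B (Complex.exp (ζ.im * Complex.I)) * s) := rfl
  have hpW : L.p ζ.im * Wθ = Complex.I * L.q ζ.im * (Wt + (1 - lam) * W ζ) + F := by
    rw [heq]
    field_simp
  rw [f1, f2, hA, hB]
  push_cast
  calc _ = (Complex.exp (lam * ζ.re) * Complex.exp ((1 - lam) * ζ.re) * (E : ℂ)⁻¹) *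
        ((L.A (Complex.exp (ζ.im * Complex.I)) * c + L.B (Complex.exp (ζ.im * Complex.I)) * s) *
          (Wt + (1 - lam) * W ζ) + L.p ζ.im * Wθ) := by
        rw [hpdef]
        ring
    _ = F := by
        rw [hexps, hpW, hqdef]
        linear_combination (L.A (Complex.exp (ζ.im * Complex.I)) * c +
          L.B (Complex.exp (ζ.im * Complex.I)) * s) * (Wt + (1 - lam) * W ζ) * Complex.I_mul_I

/-- The equation `L u = f` has a solution `u = w / r ^ (lam - 1)` in a punctured disc, with
`w` smooth and bounded. -/
theorem exists_punctured_solution (hC2 : L.CondC2) (hDC : DiophantineDC L.mu lam) {f : ℂ → ℂ}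
    (hf : AnalyticAt ℝ f 0) :
    ∃ ε : ℝ, 0 < ε ∧ ε ≤ 1 ∧ AnalyticOnNhd ℝ f (Metric.ball 0 ε) ∧ ∃ w : ℂ → ℂ,
      ContDiffOn ℝ ∞ w (Metric.ball 0 ε \ {0}) ∧
      (∃ M : ℝ, ∀ z ∈ Metric.ball (0 : ℂ) ε \ {0}, ‖w z‖ ≤ M) ∧
      ∀ z ∈ Metric.ball (0 : ℂ) ε \ {0},
        L.A z * fderiv ℝ (fun z => w z / (‖z‖ : ℂ) ^ (lam - 1)) z 1 +
          L.B z * fderiv ℝ (fun z => w z / (‖z‖ : ℂ) ^ (lam - 1)) z Complex.I = f z := by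
  obtain ⟨r, hr, hfr, F, hFc, hFh, ⟨C, K, hC, hK, hF⟩, hFs⟩ := hf.exists_homogeneous_expansion
  have hpi : 0 < 2 * Real.pi := Real.two_pi_pos
  have hpinv : ContDiff ℝ ∞ fun θ => (L.p θ)⁻¹ := L.contDiff_p.inv hC2.p_ne_zero
  have hinv := hpinv.continuous
  have hinvp : Function.Periodic (fun θ => (L.p θ)⁻¹) (2 * Real.pi) := fun θ => by
    simp only [L.periodic_p θ]
  obtain ⟨P, hP⟩ := hinvp.exists_norm_le hpi hinv
  have hP0 : 0 ≤ P := (norm_nonneg _).trans (hP 0)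
  have hhs : ContDiff ℝ ∞ fun θ => L.q θ / L.p θ := by
    simp_rw [div_eq_mul_inv]
    exact L.contDiff_q.mul hpinv
  have hhp : Function.Periodic (fun θ => L.q θ / L.p θ) (2 * Real.pi) := fun θ => by
    simp only [L.periodic_q θ, L.periodic_p θ]
  obtain ⟨H, hH⟩ := hhp.exists_norm_le hpi hhs.continuous
  have hcirc : Continuous fun θ : ℝ => Complex.exp (θ * Complex.I) := by fun_prop
  set c : ℕ → ℝ → ℂ := fun j θ => F j (Complex.exp (θ * Complex.I)) * (L.p θ)⁻¹ with hc
  have hcb : ∀ j θ, ‖c j θ‖ ≤ (C * (P + 1)) * K ^ j := fun j θ => by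
    simp only [hc]
    rw [norm_mul]
    calc _ ≤ (C * K ^ j) * (P + 1) := by
          gcongr
          · exact hF j _ (Complex.norm_exp_ofReal_mul_I θ)
          · exact (hP θ).trans (by linarith)
      _ = _ := by ring
  obtain ⟨v, D, K', hK', hvp, hvd, hvb, hcb'⟩ := exists_coefficients hC2 hDC
    (c := c) (fun j => ((hFc j).comp hcirc).mul hinv) (fun j θ => by
      have := periodic_circle θ
      simp only at this
      simp only [hc, this, L.periodic_p θ]) (by positivity) hK hcb
  -- `r` is for the expansion of `f`, the last term gives `K' * ε < 1` for convergence, and `1`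
  -- makes powers of `‖z‖` monotone in the exponent.
  set ε := min (min r 1) (1 / (2 * (K' + 1))) with hε
  have hε0 : 0 < ε := by positivity
  have hεr : ε ≤ r := (min_le_left _ _).trans (min_le_left _ _)
  have hε1 : ε ≤ 1 := (min_le_left _ _).trans (min_le_right _ _)
  have hexpT : Real.exp (Real.log ε) = ε := Real.exp_log hε0
  have hT : K' * Real.exp (Real.log ε) < 1 := by
    rw [hexpT]
    have h1 : K' * ε ≤ K' * (1 / (2 * (K' + 1))) := by
      gcongr
      exact min_le_right _ _
    refine h1.trans_lt ?_
    rw [mul_one_div, div_lt_one (by positivity)]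
    linarith
  have hmem : ∀ ζ : ℂ, ζ.re < Real.log ε → Complex.exp ζ ∈ Metric.ball (0 : ℂ) ε := fun ζ hζ => by
    rw [mem_ball_zero_iff, Complex.norm_exp]
    exact (Real.lt_log_iff_exp_lt hε0).1 hζ
  -- The forcing series sums to `f / p`, so its joint smoothness needs no bounds on derivatives of
  -- the `c j`.
  have hser : ∀ ζ : ℂ, ζ.re < Real.log ε →
      expSeries c 0 ζ = f (Complex.exp ζ) / L.p ζ.im := fun ζ hζ => by
    refine (expSeries.hasSum hcb' hK' hT 0 hζ).unique ?_
    have h1 := (hFs _ (Metric.ball_subset_ball hεr (hmem ζ hζ))).div_const (L.p ζ.im)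
    refine h1.congr_fun fun j => ?_
    rw [Complex.exp_eq_ofReal_exp_mul ζ, hFh]
    simp only [hc]
    rw [pow_zero, one_mul, Complex.ofReal_exp, ← Complex.exp_nat_mul, div_eq_mul_inv, mul_assoc]
  have hser_smooth : ContDiffOn ℝ ∞ (expSeries c 0) {ζ | ζ.re < Real.log ε} := by
    have h1 : ContDiffOn ℝ ∞ (fun ζ => f (Complex.exp ζ)) {ζ : ℂ | ζ.re < Real.log ε} :=
      (hfr.mono (Metric.ball_subset_ball hεr)).contDiffOn
        Metric.isOpen_ball.uniqueDiffOn |>.comp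
        Complex.contDiff_exp.contDiffOn fun ζ hζ => hmem ζ hζ
    refine (h1.mul (hpinv.comp Complex.imCLM.contDiff).contDiffOn).congr fun ζ hζ => ?_
    rw [hser ζ hζ, div_eq_mul_inv]
    rfl
  set W := expSeries v 0 with hW
  have hWs : ContDiffOn ℝ ∞ W {ζ | ζ.re < Real.log ε} :=
    expSeries.contDiffOn hvb hcb' hK' hT hH hhs hvd hser_smooth 0
  have hWp : Function.Periodic W (2 * Real.pi * Complex.I) := fun ζ => by
    have h1 : (ζ + 2 * Real.pi * Complex.I).re = ζ.re := by simp
    have h2 : (ζ + 2 * Real.pi * Complex.I).im = ζ.im + 2 * Real.pi := by simp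
    simp only [hW, expSeries, h1, h2]
    congr 1
    funext j
    rw [hvp j]
  have hlog : ∀ z ∈ Metric.ball (0 : ℂ) ε \ {0}, (Complex.log z).re < Real.log ε := fun z hz => by
    rw [Complex.log_re]
    exact Real.log_lt_log (norm_pos_iff.2 hz.2) (mem_ball_zero_iff.1 hz.1)
  have hws : ∀ z ∈ Metric.ball (0 : ℂ) ε \ {0},
      ContDiffAt ℝ ∞ (fun z => W (Complex.log z)) z := fun z hz =>
    contDiffAt_comp_log hWp hz.2
      (hWs.contDiffAt ((isOpen_re_lt _).mem_nhds (hlog z hz)))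
  refine ⟨ε, hε0, hε1, hfr.mono (Metric.ball_subset_ball hεr), fun z => W (Complex.log z),
    fun z hz => (hws z hz).contDiffWithinAt,
    ⟨_, fun z hz => expSeries.norm_le hvb hK' hT 0 (hlog z hz)⟩, fun z hz => ?_⟩
  have hz' : Complex.exp (Complex.log z) = z := Complex.exp_log hz.2
  have key := apply_fderiv_of_log (F := f z) (w := fun z => W (Complex.log z)) (ζ := Complex.log z)
    hC2 (by rw [hz']; exact (hws z hz).differentiableAt (by simp))
    (apply_log_exp_of_periodic hWp)
    (expSeries.hasFDerivAt hvb hcb' hK' hT hH hvd 0 (hlog z hz))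
    (by rw [hser _ (hlog z hz), hz'])
  rwa [hz'] at key

end HomogeneousVectorField

/-! ### The weak equation across the origin. -/

/-- The derivative of the product of a homogeneous function of degree `lam` and a test function is
`O(‖z‖ ^ (Re lam - 1))`. -/
theorem exists_norm_fderiv_mul_le {g Φ : ℂ → ℂ} {lam : ℂ} (hg : ContDiffOn ℝ ∞ g {0}ᶜ)
    (hgh : ∀ t : ℝ, 0 < t → ∀ z : ℂ, g (t * z) = (t : ℂ) ^ lam * g z) (hΦ : ContDiff ℝ 1 Φ)
    (hΦs : HasCompactSupport Φ) :
    ∃ M : ℝ, 0 ≤ M ∧ ∀ z : ℂ, z ≠ 0 → ‖z‖ ≤ 1 →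
      ‖fderiv ℝ (fun ζ => g ζ * Φ ζ) z‖ ≤ M * ‖z‖ ^ (lam.re - 1) := by
  obtain ⟨M₁, hM₁, h₁⟩ := exists_norm_le_of_homogeneous hg.continuousOn hgh
  obtain ⟨M₂, hM₂, h₂⟩ := exists_norm_le_of_homogeneous (g := fderiv ℝ g) (lam := lam - 1)
    (hg.continuousOn_fderiv_of_isOpen isOpen_compl_singleton (by simp))
    fun t ht z => homogeneous_fderiv hgh ht z
  obtain ⟨K₁, hK₁⟩ := hΦ.continuous.bounded_above_of_compact_support hΦs
  obtain ⟨K₂, hK₂⟩ := (hΦ.continuous_fderiv (by simp)).bounded_above_of_compact_support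
    (hΦs.fderiv ℝ)
  have hK₁0 : 0 ≤ K₁ := (norm_nonneg _).trans (hK₁ 0)
  have hK₂0 : 0 ≤ K₂ := (norm_nonneg _).trans (hK₂ 0)
  refine ⟨M₁ * K₂ + K₁ * M₂, by positivity, fun z hz hz1 => ?_⟩
  have hzpos : 0 < ‖z‖ := norm_pos_iff.2 hz
  have hgd : DifferentiableAt ℝ g z :=
    (hg.contDiffAt (isOpen_compl_singleton.mem_nhds hz)).differentiableAt (by simp)
  have h := (hgd.hasFDerivAt.mul (hΦ.differentiable (by simp) z).hasFDerivAt).fderiv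
  have h' : fderiv ℝ (fun ζ => g ζ * Φ ζ) z = g z • fderiv ℝ Φ z + Φ z • fderiv ℝ g z := h
  rw [h', add_mul]
  refine (norm_add_le _ _).trans (add_le_add ?_ ?_)
  · rw [norm_smul]
    calc ‖g z‖ * ‖fderiv ℝ Φ z‖ ≤ (M₁ * ‖z‖ ^ lam.re) * K₂ := by
          gcongr
          · exact h₁ z hz
          · exact hK₂ z
      _ ≤ (M₁ * ‖z‖ ^ (lam.re - 1)) * K₂ := by
          gcongr ?_ * K₂
          gcongr M₁ * ?_
          exact Real.rpow_le_rpow_of_exponent_ge hzpos hz1 (by linarith)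
      _ = _ := by ring
  · rw [norm_smul, mul_assoc]
    gcongr
    · exact hK₁ z
    · exact h₂ z hz

/-- This makes `A` and `B` of class `C ^ (n + 1)`, hence `ᵗL Φ` of class `C ^ n`. The natural
subtraction is not truncated, as `⌈Re lam⌉₊ ≥ 2`. -/
theorem pairingOrder_lt {lam : ℂ} (h : 1 < lam.re) : (pairingOrder lam : ℝ) < lam.re - 1 := by
  have h2 : 2 ≤ ⌈lam.re⌉₊ := Nat.lt_ceil.2 (by exact_mod_cast h)
  have h3 := Nat.ceil_lt_add_one (show 0 ≤ lam.re by linarith)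
  rw [pairingOrder, Nat.cast_sub h2]
  push_cast
  linarith

theorem le_pairingOrder_add_one {lam : ℂ} (h : 1 < lam.re) :
    lam.re - 1 ≤ (pairingOrder lam : ℝ) + 1 := by
  have h2 : 2 ≤ ⌈lam.re⌉₊ := Nat.lt_ceil.2 (by exact_mod_cast h)
  have h3 := Nat.le_ceil lam.re
  rw [pairingOrder, Nat.cast_sub h2]
  push_cast
  linarith

theorem norm_div_ofReal_norm_cpow_le {w : ℂ → ℂ} {M : ℝ} {s z : ℂ} (hz : z ≠ 0) (hw : ‖w z‖ ≤ M) :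
    ‖w z / (‖z‖ : ℂ) ^ s‖ ≤ M * ‖z‖ ^ (-s.re) := by
  have hz' : 0 < ‖z‖ := norm_pos_iff.2 hz
  rw [norm_div, Complex.norm_cpow_eq_rpow_re_of_pos hz', Real.rpow_neg hz'.le, div_eq_mul_inv]
  gcongr

namespace HomogeneousVectorField

variable {lam : ℂ} (L : HomogeneousVectorField lam)

theorem tsupport_transpose_subset (Φ : ℂ → ℂ) : tsupport (L.transpose Φ) ⊆ tsupport Φ := by
  refine closure_minimal (fun z hz => ?_) (isClosed_tsupport _)
  by_contra hz'
  have h0 := notMem_tsupport_iff_eventuallyEq.1 hz'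
  have h : ∀ g : ℂ → ℂ, fderiv ℝ (fun ζ => g ζ * Φ ζ) z = 0 := fun g => by
    have : (fun ζ => g ζ * Φ ζ) =ᶠ[nhds z] fun _ => 0 := by
      filter_upwards [h0] with x hx
      rw [hx]
      exact mul_zero _
    rw [this.fderiv_eq]
    exact fderiv_const_apply 0
  exact hz (by simp [transpose, h])

/-- The transpose of `L` maps smooth test functions to test functions of class
`C ^ pairingOrder lam`. -/
noncomputable def transposeTest {Ω : TopologicalSpace.Opens ℂ} (Φ : 𝓓(Ω, ℂ)) :
    𝓓^{(pairingOrder lam : ℕ∞)}(Ω, ℂ) where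
  toFun := L.transpose Φ
  contDiff' := by
    have hn : ((pairingOrder lam + 1 : ℕ) : ℝ) < lam.re := by
      have := pairingOrder_lt L.one_lt_re
      push_cast
      linarith
    have hA : ContDiff ℝ (pairingOrder lam + 1 : ℕ) L.A :=
      contDiff_of_homogeneous _ hn L.smooth_A L.homog_A
    have hB : ContDiff ℝ (pairingOrder lam + 1 : ℕ) L.B :=
      contDiff_of_homogeneous _ hn L.smooth_B L.homog_B
    have hΦ : ContDiff ℝ (pairingOrder lam + 1 : ℕ) Φ := contDiff_infty.1 Φ.contDiff _
    have h : ∀ m : ℕ, ((m : ℕ∞) : WithTop ℕ∞) + 1 ≤ ((m + 1 : ℕ) : WithTop ℕ∞) := fun m => by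
      norm_cast
    exact ((((hA.mul hΦ).fderiv_right (h _)).clm_apply contDiff_const).add
      (((hB.mul hΦ).fderiv_right (h _)).clm_apply contDiff_const)).neg
  hasCompactSupport' := Φ.hasCompactSupport.of_isClosed_subset (isClosed_tsupport _)
    (L.tsupport_transpose_subset _)
  tsupport_subset' := (L.tsupport_transpose_subset _).trans Φ.tsupport_subset

/-- The singularity `‖z‖ ^ (1 - Re lam)` of `u` against the zero `‖z‖ ^ Re lam` of `g` leaves
`O(‖z‖)`, so the field extends continuously by zero. -/
theorem continuous_mul_mul_test {ε M : ℝ} {g u : ℂ → ℂ} (hε : 0 < ε) (hlam : 0 < lam.re)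
    (hg : ContDiffOn ℝ ∞ g {0}ᶜ)
    (hgh : ∀ t : ℝ, 0 < t → ∀ z : ℂ, g (t * z) = (t : ℂ) ^ lam * g z)
    (hud : ∀ z ∈ Metric.ball (0 : ℂ) ε \ {0}, DifferentiableAt ℝ u z)
    (hub : ∀ z ∈ Metric.ball (0 : ℂ) ε \ {0}, ‖u z‖ ≤ M * ‖z‖ ^ (1 - lam.re))
    (Φ : 𝓓(disc ε, ℂ)) :
    Continuous (fun z => u z * (g z * Φ z)) ∧
      ∀ z ≠ 0, DifferentiableAt ℝ (fun z => u z * (g z * Φ z)) z := by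
  have hd : ∀ z ≠ 0, DifferentiableAt ℝ (fun z => u z * (g z * Φ z)) z := fun z hz => by
    by_cases hzΦ : z ∈ tsupport Φ
    · have hgd : DifferentiableAt ℝ g z :=
        (hg.contDiffAt (isOpen_compl_singleton.mem_nhds hz)).differentiableAt (by simp)
      exact (hud z ⟨Φ.tsupport_subset hzΦ, hz⟩).mul
        (hgd.mul (Φ.contDiff.differentiable (by simp) z))
    · have h : (fun z => u z * (g z * Φ z)) =ᶠ[nhds z] fun _ => 0 := by
        filter_upwards [notMem_tsupport_iff_eventuallyEq.1 hzΦ] with x hx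
        rw [hx]
        simp
      exact (differentiableAt_const _).congr_of_eventuallyEq h
  refine ⟨continuous_iff_continuousAt.2 fun z => ?_, hd⟩
  rcases eq_or_ne z 0 with rfl | hz
  · obtain ⟨M₁, hM₁, h₁⟩ := exists_norm_le_of_homogeneous hg.continuousOn hgh
    obtain ⟨K, hK⟩ := Φ.continuous.bounded_above_of_compact_support Φ.hasCompactSupport
    have hg0 : g 0 = 0 := homogeneous_apply_zero hlam hgh
    rw [ContinuousAt, hg0, zero_mul, mul_zero]
    refine squeeze_zero_norm' (a := fun z => M * M₁ * K * ‖z‖) ?_ ?_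
    · filter_upwards [Metric.ball_mem_nhds (0 : ℂ) hε] with z hz
      rcases eq_or_ne z 0 with rfl | hz0
      · simp [hg0]
      · have hzpos : 0 < ‖z‖ := norm_pos_iff.2 hz0
        have hu := hub z ⟨hz, hz0⟩
        rw [norm_mul, norm_mul]
        calc ‖u z‖ * (‖g z‖ * ‖Φ z‖)
            ≤ (M * ‖z‖ ^ (1 - lam.re)) * ((M₁ * ‖z‖ ^ lam.re) * K) := by
              have := (norm_nonneg _).trans hu
              gcongr
              · exact h₁ z hz0
              · exact hK z
          _ = M * M₁ * K * (‖z‖ ^ (1 - lam.re) * ‖z‖ ^ lam.re) := by ring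
          _ = _ := by rw [← Real.rpow_add hzpos, sub_add_cancel, Real.rpow_one]
    · have : Continuous fun z : ℂ => M * M₁ * K * ‖z‖ := by fun_prop
      simpa using this.tendsto 0
  · exact (hd z hz).continuousAt

open MeasureTheory

/-- A solution of `L u = f` in a punctured disc of size `O(‖z‖ ^ (1 - Re lam))` satisfies the
equation weakly in the whole disc. -/
theorem setIntegral_mul_transpose {ε M : ℝ} {u f : ℂ → ℂ} (hε : 0 < ε) (hε1 : ε ≤ 1)
    (hfc : ContinuousOn f (Metric.ball 0 ε))
    (hud : ∀ z ∈ Metric.ball (0 : ℂ) ε \ {0}, DifferentiableAt ℝ u z)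
    (hub : ∀ z ∈ Metric.ball (0 : ℂ) ε \ {0}, ‖u z‖ ≤ M * ‖z‖ ^ (1 - lam.re))
    (hum : AEStronglyMeasurable u (volume.restrict (Metric.ball 0 ε)))
    (hLu : ∀ z ∈ Metric.ball (0 : ℂ) ε \ {0},
      L.A z * fderiv ℝ u z 1 + L.B z * fderiv ℝ u z Complex.I = f z)
    (Φ : 𝓓(disc ε, ℂ)) :
    IntegrableOn (fun z => u z * L.transpose Φ z) (Metric.ball 0 ε) ∧
      ∫ z in Metric.ball 0 ε, u z * L.transpose Φ z = ∫ z in Metric.ball 0 ε, f z * Φ z := by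
  have hlam : 0 < lam.re := zero_lt_one.trans L.one_lt_re
  have hΦ1 : ContDiff ℝ 1 Φ := Φ.contDiff.of_le (by exact_mod_cast le_top)
  have hΨ : Continuous (L.transpose Φ) := (L.transposeTest Φ).continuous
  have hball : ∀ z, z ∉ Metric.ball (0 : ℂ) ε → z ∉ tsupport Φ := fun z hz h =>
    hz (Φ.tsupport_subset h)
  have hfΦ : Integrable fun z => f z * Φ z := by
    refine Continuous.integrable_of_hasCompactSupport (continuous_iff_continuousAt.2 fun z => ?_)
      Φ.hasCompactSupport.mul_left
    by_cases hz : z ∈ Metric.ball (0 : ℂ) ε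
    · exact (hfc.continuousAt (Metric.isOpen_ball.mem_nhds hz)).mul Φ.continuous.continuousAt
    · refine continuousAt_const.congr (f := fun _ => 0) ?_
      filter_upwards [notMem_tsupport_iff_eventuallyEq.1 (hball z hz)] with x hx
      rw [hx]
      simp
  have hae : ∀ᵐ z ∂volume.restrict (Metric.ball (0 : ℂ) ε), z ∈ Metric.ball (0 : ℂ) ε \ {0} := by
    filter_upwards [ae_restrict_mem measurableSet_ball,
      ae_restrict_of_ae (show ∀ᵐ z : ℂ, z ≠ 0 by simp [ae_iff])] with z hz hz0
    exact ⟨hz, hz0⟩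
  have huΨ : IntegrableOn (fun z => u z * L.transpose Φ z) (Metric.ball 0 ε) := by
    obtain ⟨MA, hMA, hA⟩ := exists_norm_fderiv_mul_le L.smooth_A L.homog_A hΦ1 Φ.hasCompactSupport
    obtain ⟨MB, hMB, hB⟩ := exists_norm_fderiv_mul_le L.smooth_B L.homog_B hΦ1 Φ.hasCompactSupport
    have : IsFiniteMeasure (volume.restrict (Metric.ball (0 : ℂ) ε)) :=
      isFiniteMeasure_restrict.2 measure_ball_lt_top.ne
    -- The exponents `1 - Re lam` and `Re lam - 1` cancel, so the integrand is bounded.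
    refine Integrable.of_bound (hum.mul hΨ.aestronglyMeasurable) (M * (MA + MB)) ?_
    filter_upwards [hae] with z hz
    have hzpos : 0 < ‖z‖ := norm_pos_iff.2 hz.2
    have hz1 : ‖z‖ ≤ 1 := (mem_ball_zero_iff.1 hz.1).le.trans hε1
    have hu := hub z hz
    have hT : ‖L.transpose Φ z‖ ≤ (MA + MB) * ‖z‖ ^ (lam.re - 1) := by
      rw [transpose, norm_neg, add_mul]
      refine (norm_add_le _ _).trans (add_le_add ?_ ?_)
      · refine (ContinuousLinearMap.le_opNorm _ _).trans ?_
        rw [norm_one, mul_one]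
        exact hA z hz.2 hz1
      · refine (ContinuousLinearMap.le_opNorm _ _).trans ?_
        rw [Complex.norm_I, mul_one]
        exact hB z hz.2 hz1
    rw [norm_mul]
    calc ‖u z‖ * ‖L.transpose Φ z‖
        ≤ (M * ‖z‖ ^ (1 - lam.re)) * ((MA + MB) * ‖z‖ ^ (lam.re - 1)) := by
          have := (norm_nonneg _).trans hu
          gcongr
      _ = M * (MA + MB) * (‖z‖ ^ (1 - lam.re) * ‖z‖ ^ (lam.re - 1)) := by ring
      _ = _ := by
          rw [← Real.rpow_add hzpos, sub_add_sub_cancel, sub_self, Real.rpow_zero, mul_one]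
  refine ⟨huΨ, ?_⟩
  obtain ⟨hc₁, hd₁⟩ := continuous_mul_mul_test hε hlam L.smooth_A L.homog_A hud hub Φ
  obtain ⟨hc₂, hd₂⟩ := continuous_mul_mul_test hε hlam L.smooth_B L.homog_B hud hub Φ
  have hvan : ∀ z, ε ≤ ‖z‖ → Φ z = 0 := fun z hz =>
    image_eq_zero_of_notMem_tsupport (hball z (by simpa using hz))
  -- The field `(u A Φ, u B Φ)` has divergence `(L u) Φ - u ᵗL Φ` outside the origin.
  have key := integral_divergence_eq_zero (R := ε)
    (φ := (Metric.ball (0 : ℂ) ε).indicator fun z => f z * Φ z - u z * L.transpose Φ z)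
    hc₁ hc₂ hd₁ hd₂
    (fun z hz => by simp [hvan z hz]) (fun z hz => by simp [hvan z hz]) (fun z hz => ?_)
    ((integrable_indicator_iff measurableSet_ball).2 (hfΦ.integrableOn.sub huΨ))
  · rw [integral_indicator measurableSet_ball, integral_sub hfΦ.integrableOn huΨ] at key
    exact (sub_eq_zero.1 key).symm
  · by_cases hzb : z ∈ Metric.ball (0 : ℂ) ε
    · rw [Set.indicator_of_mem hzb]
      have hu := (hud z ⟨hzb, hz⟩).hasFDerivAt
      have hmul : ∀ g : ℂ → ℂ, ContDiffOn ℝ ∞ g {0}ᶜ →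
          fderiv ℝ (fun z => u z * (g z * Φ z)) z =
            u z • fderiv ℝ (fun z => g z * Φ z) z + (g z * Φ z) • fderiv ℝ u z := fun g hg => by
        have hgd : DifferentiableAt ℝ g z :=
          (hg.contDiffAt (isOpen_compl_singleton.mem_nhds hz)).differentiableAt (by simp)
        exact (hu.mul (hgd.fun_mul (hΦ1.differentiable (by simp) z)).hasFDerivAt).fderiv
      rw [hmul _ L.smooth_A, hmul _ L.smooth_B, ← hLu z ⟨hzb, hz⟩, transpose]
      simp only [_root_.add_apply, _root_.smul_apply, smul_eq_mul]
      ring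
    · rw [Set.indicator_of_notMem hzb]
      have h0 : ∀ g : ℂ → ℂ, fderiv ℝ (fun z => u z * (g z * Φ z)) z = 0 := fun g => by
        have : (fun z => u z * (g z * Φ z)) =ᶠ[nhds z] fun _ => 0 := by
          filter_upwards [notMem_tsupport_iff_eventuallyEq.1 (hball z hzb)] with x hx
          rw [hx]
          simp
        rw [this.fderiv_eq]
        exact fderiv_const_apply 0
      rw [h0, h0]
      simp

/-- A solution of `L u = f` in a punctured disc of size `O(‖z‖ ^ (1 - Re lam))` is a distribution
solution in the whole disc. -/
theorem isDistributionSolution_of_punctured {ε M : ℝ} {u f : ℂ → ℂ} (hε : 0 < ε) (hε1 : ε ≤ 1)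
    (hfc : ContinuousOn f (Metric.ball 0 ε))
    (hud : ∀ z ∈ Metric.ball (0 : ℂ) ε \ {0}, DifferentiableAt ℝ u z)
    (hub : ∀ z ∈ Metric.ball (0 : ℂ) ε \ {0}, ‖u z‖ ≤ M * ‖z‖ ^ (1 - lam.re))
    (hLu : ∀ z ∈ Metric.ball (0 : ℂ) ε \ {0},
      L.A z * fderiv ℝ u z 1 + L.B z * fderiv ℝ u z Complex.I = f z) :
    IsDistributionSolution L (disc ε) u f := by
  have hum : AEStronglyMeasurable u (volume.restrict (Metric.ball 0 ε)) := by
    rw [← Measure.restrict_congr_set (sdiff_null_ae_eq_self (measure_singleton (0 : ℂ)))]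
    exact ContinuousOn.aestronglyMeasurable
      (fun z hz => (hud z hz).continuousAt.continuousWithinAt)
      (measurableSet_ball.diff (measurableSet_singleton 0))
  have hae : ∀ᵐ z ∂volume.restrict (Metric.ball (0 : ℂ) ε), z ∈ Metric.ball (0 : ℂ) ε \ {0} := by
    filter_upwards [ae_restrict_mem measurableSet_ball,
      ae_restrict_of_ae (show ∀ᵐ z : ℂ, z ≠ 0 by simp [ae_iff])] with z hz hz0
    exact ⟨hz, hz0⟩
  have hint : IntegrableOn (fun z => ‖z‖ ^ pairingOrder lam * ‖u z‖) (Metric.ball 0 ε) := by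
    -- The majorant `‖z‖⁻¹` is integrable near the origin in dimension two; it suffices because `n +
    -- 1 - Re lam ≥ -1`.
    have h1 : IntegrableOn (fun z : ℂ => M * ‖z‖ ^ (-1 : ℝ)) (Metric.ball 0 ε) := by
      refine integrableOn_ball_of_norm_le_rpow (C := |M|) (α := 1)
        (by rw [Complex.finrank_real_complex]; norm_num)
        (by rw [Complex.finrank_real_complex]; norm_num)
        (Filter.Eventually.of_forall fun z => ?_) ?_
      · rw [norm_mul, Real.norm_eq_abs, Real.norm_of_nonneg (by positivity)]
      · exact (by fun_prop : Measurable fun z : ℂ => M * ‖z‖ ^ (-1 : ℝ)).aestronglyMeasurable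
    refine h1.mono' ((by fun_prop : Continuous fun z : ℂ =>
      ‖z‖ ^ pairingOrder lam).aestronglyMeasurable.mul hum.norm) ?_
    filter_upwards [hae] with z hz
    have hzpos : 0 < ‖z‖ := norm_pos_iff.2 hz.2
    have hz1 : ‖z‖ ≤ 1 := (mem_ball_zero_iff.1 hz.1).le.trans hε1
    have hu := hub z hz
    have hM : 0 ≤ M := by
      have := (norm_nonneg _).trans hu
      exact nonneg_of_mul_nonneg_left this (by positivity)
    rw [norm_mul, norm_pow, norm_norm, norm_norm]
    calc ‖z‖ ^ pairingOrder lam * ‖u z‖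
        ≤ ‖z‖ ^ (pairingOrder lam : ℝ) * (M * ‖z‖ ^ (1 - lam.re)) := by
          rw [Real.rpow_natCast]
          gcongr
      _ = M * ‖z‖ ^ ((pairingOrder lam : ℝ) + (1 - lam.re)) := by
          rw [Real.rpow_add hzpos]
          ring
      _ ≤ M * ‖z‖ ^ (-1 : ℝ) := by
          gcongr M * ?_
          refine Real.rpow_le_rpow_of_exponent_ge hzpos hz1 ?_
          have := le_pairingOrder_add_one L.one_lt_re
          linarith
  obtain ⟨U, hU⟩ := exists_isGivenBy (Ω := disc ε) (pairingOrder lam) u hum hint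
  refine ⟨U, hU, fun Φ => ⟨L.transposeTest Φ, fun z => rfl, ?_⟩⟩
  obtain ⟨h1, h2⟩ := L.setIntegral_mul_transpose hε hε1 hfc hud hub hum hLu Φ
  -- As `u ᵗL Φ` is integrable, the value of `U` there is the plain integral, whatever
  -- regularization was chosen.
  exact (hU (L.transposeTest Φ) h1).trans h2

end HomogeneousVectorField

theorem theorem6p1 {lam : ℂ} (L : HomogeneousVectorField lam)
    (hC1 : L.CondC1) (hC2 : L.CondC2)
    (hmu : L.mu ≠ 0) (hres : ¬ IsResonant L.mu lam) (hDC : DiophantineDC L.mu lam)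
    (f : ℂ → ℂ) (hf : AnalyticAt ℝ f 0) :
    ∃ ε : ℝ, 0 < ε ∧ AnalyticOnNhd ℝ f (Metric.ball 0 ε) ∧
      ∃ w : ℂ → ℂ,
        ContDiffOn ℝ ∞ w (Metric.ball 0 ε \ {0}) ∧
        (∃ M : ℝ, ∀ z ∈ Metric.ball (0 : ℂ) ε \ {0}, ‖w z‖ ≤ M) ∧
        IsDistributionSolution L (disc ε) (fun z => w z / (‖z‖ : ℂ) ^ (lam - 1)) f := by
  obtain ⟨ε, hε, hε1, hfε, w, hws, ⟨M, hM⟩, hLw⟩ :=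
    HomogeneousVectorField.exists_punctured_solution hC2 hDC hf
  have hopen : IsOpen (Metric.ball (0 : ℂ) ε \ {0}) :=
    Metric.isOpen_ball.sdiff isClosed_singleton
  refine ⟨ε, hε, hfε, w, hws, ⟨M, hM⟩, L.isDistributionSolution_of_punctured (M := M) hε hε1
    hfε.continuousOn (fun z hz => ?_) (fun z hz => ?_) hLw⟩
  · exact differentiableAt_div_ofReal_norm_cpow _ hz.2
      ((hws.contDiffAt (hopen.mem_nhds hz)).differentiableAt (by simp))
  · have := norm_div_ofReal_norm_cpow_le (s := lam - 1) hz.2 (hM z hz)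
    rwa [Complex.sub_re, Complex.one_re, neg_sub] at this
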